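/- Let $\mathbb{K}=\mathbb{R}$ or $\mathbb{C}$ and let $\mathcal{M}=\{R(x,y,a,b)=0\}\subset\mathbb{K}^{n+1}\times\mathbb{K}^{m+1}$, with $x\in\mathbb{K}^n$, $y\in\mathbb{K}$, $a\in\mathbb{K}^m$, $b\in\mathbb{K}$, be a local submanifold of solutions: $R$ is a $\mathbb{K}$-analytic function near the origin with $R(0)=0$ and $R_y(0)\neq 0\neq R_b(0)$. Let $y=Q(x,a,b)$ and $b=P(a,x,y)$ be the two graphed equations of $\mathcal{M}$ near $0$, obtained by solving $R=0$, and expand $Q=\sum_{\beta\in\mathbb{N}^n}x^\beta Q_\beta(a,b)$, $P=\sum_{\gamma\in\mathbb{N}^m}a^\gamma P_\gamma(x,y)$. The generic rank of an analytic map near $0$ is the largest rank that it attains at points arbitrarily close to $0$. Then the generic ranks near $0$ of $(a,b)\mapsto(Q_\beta(a,b))_{\beta\in\mathbb{N}^n}$ and $(x,y)\mapsto(P_\gamma(x,y))_{\gamma\in\mathbb{N}^m}$ are of the form $1+m_{\mathcal{M}}$ and $1+n_{\mathcal{M}}$ with integers $0\le m_{\mathcal{M}}\le m$, $0\le n_{\mathcal{M}}\le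 n$, and in arbitrarily small open neighborhoods of $0$ there is an open neighborhood $\Omega$ of $0$ on which $R$ is analytic with $R_y\neq0\neq R_b$ and such that $\mathcal{M}\cap\Omega$ is connected, and there is a nowhere dense analytic subset $Z$ of $\mathcal{M}\cap\Omega$, such that the following holds at every point $p\in(\mathcal{M}\cap\Omega)\setminus Z$. (1) There is a $\mathbb{K}$-analytic split-diffeomorphism $(x,y,a,b)\mapsto(f(x,y),g(x,y),\varphi(a,b),\psi(a,b))=(x',y',a',b')$ from a product neighborhood of $p$ in $\Omega$ onto a product $U'\times V'$ of open sets $U'\subset\mathbb{K}^{n+1}$, $V'\subset\mathbb{K}^{m+1}$, sending $p$ to $0$, which transforms $\mathcal{M}$ into a submanifold $\mathcal{M}'\subset U'\times V'$ having analytic equations $$y'=Q'(x',a',b')\iff b'=P'(a',x',y'),$$ in which both $Q'$ and $P'$ are independent of the coordinates $x'_{n_{\mathcal{M}}+1},\dots,x'_n$ and $a'_{m_{\mathcal{M}}+1},\dots,a'_m$. (2) Let $\mathcal{M}'_{\mathrm{reduced}}\subset\mathbb{K}^{n_{\mathcal{M}}+1}\times\mathbb{K}^{m_{\mathcal{M}}+1}$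 be the submanifold defined by these same equations in the remaining coordinates $x'_1,\dots,x'_{n_{\mathcal{M}}},y'$ and $a'_1,\dots,a'_{m_{\mathcal{M}}},b'$, in the product of the projections of $U'$ and $V'$. At every point of $\mathcal{M}'_{\mathrm{reduced}}$ it is finitely nondegenerate with respect to parameters, i.e. for some integer $k\ge0$ the map $(x',a',b')\mapsto\big(x',(\partial_{x'}^\beta Q'(x',a',b'))_{|\beta|\le k}\big)$ has rank $n_{\mathcal{M}}+1+m_{\mathcal{M}}$ there, and finitely nondegenerate with respect to variables, i.e. for some integer $l\ge0$ the map $(a',x',y')\mapsto\big(a',(\partial_{a'}^\gamma P'(a',x',y'))_{|\gamma|\le l}\big)$ has rank $m_{\mathcal{M}}+1+n_{\mathcal{M}}$ there. (3) In a neighborhood of any of its points, $\mathcal{M}'_{\mathrm{reduced}}$ is not equivalent, through a local analytic split-diffeomorphism, to an open piece of any product $\mathbb{K}^1_{\mathrm{var}}\times N$ with $N\subset\mathbb{K}^{n_{\mathcal{M}}}\times\mathbb{K}^{m_{\mathcal{M}}+1}$, nor of any product $N\times\mathbb{K}^1_{\mathrm{par}}$ with $N\subset\mathbb{K}^{n_{\mathcal{M}}+1}\times\mathbb{K}^{m_{\mathcal{M}}}$.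 Here $\mathbb{K}^1_{\mathrm{var}}$ (resp. $\mathbb{K}^1_{\mathrm{par}}$) is a factor of the space of variables $\mathbb{K}^{n_{\mathcal{M}}+1}$ (resp. of the space of parameters $\mathbb{K}^{m_{\mathcal{M}}+1}$). -/

import Mathlib

namespace ParaCR

open Topology
open scoped ContDiff

/-- The space `𝕜^k × 𝕜` of points `(x, y)` (variables, `k = n`) or `(a, b)` (parameters, `k = m`). -/
abbrev Pt (𝕜 : Type*) (k : ℕ) : Type _ := (Fin k → 𝕜) × 𝕜

/-! ### Submanifolds of solutions and their graphing functions -/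

/-- A germ at the origin of a submanifold of solutions `{R(x, y, a, b) = 0}` in
`𝕜^{n+1} × 𝕜^{m+1}`: `R` is analytic at `0`, vanishes at `0`, and `R_y(0) ≠ 0 ≠ R_b(0)`. -/
structure SolutionSubmanifold (𝕜 : Type*) [RCLike 𝕜] (n m : ℕ) where
  R : Pt 𝕜 n × Pt 𝕜 m → 𝕜
  analyticAt : AnalyticAt 𝕜 R 0
  map_zero : R 0 = 0
  deriv_y_ne : fderiv 𝕜 R 0 ((0, 1), 0) ≠ 0
  deriv_b_ne : fderiv 𝕜 R 0 (0, (0, 1)) ≠ 0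

/-- `Q(x, a, b)` is the germ of the graphing function of `{R = 0}` solved for `y`. -/
def IsGraphingFunction {𝕜 : Type*} [RCLike 𝕜] {n m : ℕ}
    (R : Pt 𝕜 n × Pt 𝕜 m → 𝕜) (Q : (Fin n → 𝕜) × Pt 𝕜 m → 𝕜) : Prop :=
  AnalyticAt 𝕜 Q 0 ∧ Q 0 = 0 ∧
    ∀ᶠ p : Pt 𝕜 n × Pt 𝕜 m in 𝓝 0, R p = 0 ↔ p.1.2 = Q (p.1.1, p.2)

namespace SolutionSubmanifold

variable {𝕜 : Type*} [RCLike 𝕜] {n m : ℕ}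

/-- The same submanifold with the roles of variables and parameters exchanged. -/
def dual (M : SolutionSubmanifold 𝕜 n m) : SolutionSubmanifold 𝕜 m n where
  R := fun p => M.R p.swap
  analyticAt := by
    have h : AnalyticAt 𝕜 M.R ((Prod.swap : Pt 𝕜 m × Pt 𝕜 n → _) 0) := M.analyticAt
    exact h.comp (analyticAt_snd.prod analyticAt_fst)
  map_zero := M.map_zero
  deriv_y_ne := by
    have h : fderiv 𝕜 (fun p : Pt 𝕜 m × Pt 𝕜 n => M.R p.swap) 0 =
        (fderiv 𝕜 M.R 0).comp
          (ContinuousLinearEquiv.prodComm 𝕜 (Pt 𝕜 m) (Pt 𝕜 n) : _ →L[𝕜] _) :=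
      (ContinuousLinearEquiv.prodComm 𝕜 (Pt 𝕜 m) (Pt 𝕜 n)).comp_right_fderiv (f := M.R) (x := 0)
    rw [h]
    exact M.deriv_b_ne
  deriv_b_ne := by
    have h : fderiv 𝕜 (fun p : Pt 𝕜 m × Pt 𝕜 n => M.R p.swap) 0 =
        (fderiv 𝕜 M.R 0).comp
          (ContinuousLinearEquiv.prodComm 𝕜 (Pt 𝕜 m) (Pt 𝕜 n) : _ →L[𝕜] _) :=
      (ContinuousLinearEquiv.prodComm 𝕜 (Pt 𝕜 m) (Pt 𝕜 n)).comp_right_fderiv (f := M.R) (x := 0)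
    rw [h]
    exact M.deriv_y_ne

/-- Analytic implicit function theorem: the graphing function solved for `y` exists. -/
theorem exists_graphingFunction (M : SolutionSubmanifold 𝕜 n m) :
    ∃ Q : (Fin n → 𝕜) × Pt 𝕜 m → 𝕜, IsGraphingFunction M.R Q := by
  let σ : (((Fin n → 𝕜) × Pt 𝕜 m) × 𝕜) ≃L[𝕜] (Pt 𝕜 n × Pt 𝕜 m) :=
    ((ContinuousLinearEquiv.prodAssoc 𝕜 (Fin n → 𝕜) (Pt 𝕜 m) 𝕜).trans
      ((ContinuousLinearEquiv.refl 𝕜 (Fin n → 𝕜)).prodCongr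
        (ContinuousLinearEquiv.prodComm 𝕜 (Pt 𝕜 m) 𝕜))).trans
      (ContinuousLinearEquiv.prodAssoc 𝕜 (Fin n → 𝕜) 𝕜 (Pt 𝕜 m)).symm
  have hσ : ∀ x ab y, σ ((x, ab), y) = ((x, y), ab) := fun _ _ _ => rfl
  have hσ0 : σ 0 = 0 := σ.map_zero
  have cdf : ContDiffAt 𝕜 ω (M.R ∘ σ) 0 := by
    refine ContDiffAt.comp (0 : ((Fin n → 𝕜) × Pt 𝕜 m) × 𝕜) ?_ σ.contDiff.contDiffAt
    rw [hσ0]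
    exact M.analyticAt.contDiffAt
  have hd : fderiv 𝕜 (M.R ∘ σ) 0 = (fderiv 𝕜 M.R 0).comp (σ : _ →L[𝕜] _) := by
    rw [σ.comp_right_fderiv, hσ0]
  have hinv : (fderiv 𝕜 (M.R ∘ σ) 0 ∘L .inr 𝕜 ((Fin n → 𝕜) × Pt 𝕜 m) 𝕜).IsInvertible := by
    refine ⟨ContinuousLinearEquiv.unitsEquivAut 𝕜 (Units.mk0 _ M.deriv_y_ne), ?_⟩
    ext
    rw [hd]
    simp [ContinuousLinearEquiv.unitsEquivAut]
    rfl
  have hω : (ω : WithTop ℕ∞) ≠ 0 := by simp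
  refine ⟨cdf.implicitFunction hω hinv, ?_, ?_, ?_⟩
  · exact (cdf.contDiffAt_implicitFunction hω hinv).analyticAt
  · exact cdf.implicitFunction_apply_self hω hinv
  · have h := cdf.eventually_apply_eq_iff_implicitFunction hω hinv
    have ht : Filter.Tendsto σ.symm (𝓝 0) (𝓝 0) := by
      simpa using σ.symm.continuous.tendsto 0
    filter_upwards [ht.eventually h] with p hp
    have e : σ (σ.symm p) = p := σ.apply_symm_apply p
    have e0 : M.R (σ 0) = 0 := by rw [hσ0, M.map_zero]
    simp only [Function.comp_apply, e, e0] at hp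
    rw [hp]
    exact eq_comm

/-- The graphing function `Q` in `M = {y = Q(x, a, b)}` (its germ at `0` is unique). -/
noncomputable def Q (M : SolutionSubmanifold 𝕜 n m) : (Fin n → 𝕜) × Pt 𝕜 m → 𝕜 :=
  Classical.choose M.exists_graphingFunction

/-- The graphing function `P` in `M = {b = P(a, x, y)}` (its germ at `0` is unique). -/
noncomputable def P (M : SolutionSubmanifold 𝕜 n m) : (Fin m → 𝕜) × Pt 𝕜 n → 𝕜 :=
  M.dual.Q

theorem isGraphingFunction_Q (M : SolutionSubmanifold 𝕜 n m) : IsGraphingFunction M.R M.Q :=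
  Classical.choose_spec M.exists_graphingFunction

/-- The representative `{R = 0} ∩ Ω` of the germ. -/
def locus (M : SolutionSubmanifold 𝕜 n m) (Ω : Set (Pt 𝕜 n × Pt 𝕜 m)) :
    Set (Pt 𝕜 n × Pt 𝕜 m) :=
  {p | p ∈ Ω ∧ M.R p = 0}

/-- `Ω` is a domain on which `{R = 0}` is a connected submanifold of solutions: an open
neighbourhood of `0` on which `R` is analytic with `R_y ≠ 0 ≠ R_b`, and `{R = 0} ∩ Ω` is
connected. -/
structure IsAdmissibleDomain (M : SolutionSubmanifold 𝕜 n m) (Ω : Set (Pt 𝕜 n × Pt 𝕜 m)) : Prop where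
  isOpen : IsOpen Ω
  zero_mem : (0 : Pt 𝕜 n × Pt 𝕜 m) ∈ Ω
  analytic : AnalyticOnNhd 𝕜 M.R Ω
  deriv_y_ne : ∀ p ∈ Ω, fderiv 𝕜 M.R p ((0, 1), 0) ≠ 0
  deriv_b_ne : ∀ p ∈ Ω, fderiv 𝕜 M.R p (0, (0, 1)) ≠ 0
  connected : IsConnected (M.locus Ω)

end SolutionSubmanifold

/-! ### Jets, ranks, generic ranks -/

section Jets

variable {𝕜 : Type*} [RCLike 𝕜]

/-- The partial derivative `∂^β f (x) = ∂₁^{β₁} ⋯ ∂ₖ^{βₖ} f (x)`: the derivative of order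
`|β| = β₁ + ⋯ + βₖ` evaluated on `β₁` copies of `e₁`, followed by `β₂` copies of `e₂`, etc. -/
noncomputable def mixedPartial {k : ℕ} (β : Fin k → ℕ) (f : (Fin k → 𝕜) → 𝕜) (x : Fin k → 𝕜) : 𝕜 :=
  iteratedFDeriv 𝕜 (∑ i, β i) f x (fun t => Pi.single (finSigmaFinEquiv.symm t).1 1)

/-- The rank at `p` of the map `q ↦ (f i q)_i` with (possibly infinitely many) scalar components:
the dimension of the space spanned by the differentials at `p` of the components. -/
noncomputable def rankAt {E : Type*} [NormedAddCommGroup E] [NormedSpace 𝕜 E] {ι : Type*}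
    (f : ι → E → 𝕜) (p : E) : ℕ :=
  Module.finrank 𝕜 (Submodule.span 𝕜 (Set.range fun i => fderiv 𝕜 (f i) p))

/-- The generic rank near `p₀` of the (germ at `p₀` of a) map `q ↦ (f i q)_i`: the largest
rank attained at points arbitrarily close to `p₀`, i.e. the least `r` such that the rank is at
most `r` at all points near `p₀`. -/
noncomputable def genericRank {E : Type*} [NormedAddCommGroup E] [NormedSpace 𝕜 E] {ι : Type*}
    (f : ι → E → 𝕜) (p₀ : E) : ℕ :=
  sInf {r : ℕ | ∀ᶠ q in 𝓝 p₀, rankAt f q ≤ r}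

/-- The components `Q_β(a, b)`, `β ∈ ℕ^k`, of the infinite coefficient map, where
`Q(x, a, b) = ∑_β x^β Q_β(a, b)`. -/
noncomputable def coeffMap {k l : ℕ} (Q : (Fin k → 𝕜) × Pt 𝕜 l → 𝕜) (β : Fin k → ℕ)
    (ab : Pt 𝕜 l) : 𝕜 :=
  ((∏ i, (β i).factorial : ℕ) : 𝕜)⁻¹ * mixedPartial β (fun x => Q (x, ab)) 0

/-- The components of the jet map `(x, a, b) ↦ (x, (∂_x^β Q(x, a, b))_{|β| ≤ j})` of order `j`. -/
noncomputable def jetMap {k l : ℕ} (j : ℕ) (Q : (Fin k → 𝕜) × Pt 𝕜 l → 𝕜) :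
    Fin k ⊕ {β : Fin k → ℕ // ∑ i, β i ≤ j} → (Fin k → 𝕜) × Pt 𝕜 l → 𝕜 :=
  Sum.elim (fun i p => p.1 i) (fun β p => mixedPartial β.1 (fun x => Q (x, p.2)) p.1)

/-- For `Q = Q(x, a, b)` this is finite nondegeneracy of `{y = Q(x, a, b)}` with respect to
parameters at `(x, a, b)`; for `P = P(a, x, y)` it is finite nondegeneracy of
`{b = P(a, x, y)}` with respect to variables at `(a, x, y)`: some jet map has the maximal possible
rank `k + 1 + l` at the point. -/
def FinitelyNondegenerateAt {k l : ℕ} (Q : (Fin k → 𝕜) × Pt 𝕜 l → 𝕜)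
    (p : (Fin k → 𝕜) × Pt 𝕜 l) : Prop :=
  ∃ j : ℕ, rankAt (jetMap j Q) p = k + 1 + l

end Jets

namespace SolutionSubmanifold

variable {𝕜 : Type*} [RCLike 𝕜] {n m : ℕ}

/-- Generic rank of the infinite coefficient map `(a, b) ↦ (Q_β(a, b))_β`. -/
noncomputable def genrankPar (M : SolutionSubmanifold 𝕜 n m) : ℕ := genericRank (coeffMap M.Q) 0

/-- Generic rank of the infinite coefficient map `(x, y) ↦ (P_γ(x, y))_γ`. -/
noncomputable def genrankVar (M : SolutionSubmanifold 𝕜 n m) : ℕ := genericRank (coeffMap M.P) 0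

end SolutionSubmanifold

/-! ### Analytic subsets, split diffeomorphisms, graphs -/

/-- `Z` is an analytic subset of `S`: near every point of `S` it is the set of common zeros in `S`
of finitely many analytic functions. -/
def IsAnalyticSubset (𝕜 : Type*) [RCLike 𝕜] {E : Type*} [NormedAddCommGroup E] [NormedSpace 𝕜 E]
    (Z S : Set E) : Prop :=
  Z ⊆ S ∧ ∀ p ∈ S, ∃ W : Set E, IsOpen W ∧ p ∈ W ∧ ∃ (N : ℕ) (h : Fin N → E → 𝕜),
    (∀ i, AnalyticOnNhd 𝕜 (h i) W) ∧ Z ∩ W = {q | q ∈ S ∩ W ∧ ∀ i, h i q = 0}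

/-- A local analytic split diffeomorphism `(v, w) ↦ (F(v), Φ(w))`, defined for `v` and `w` in open
sets and with analytic inverse. -/
structure SplitDiffeo (𝕜 : Type*) [RCLike 𝕜] (E E' G G' : Type*)
    [NormedAddCommGroup E] [NormedSpace 𝕜 E] [NormedAddCommGroup E'] [NormedSpace 𝕜 E']
    [NormedAddCommGroup G] [NormedSpace 𝕜 G] [NormedAddCommGroup G'] [NormedSpace 𝕜 G'] where
  F : OpenPartialHomeomorph E G
  Φ : OpenPartialHomeomorph E' G'
  analytic_F : AnalyticOnNhd 𝕜 F F.source
  analytic_F_symm : AnalyticOnNhd 𝕜 F.symm F.target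
  analytic_Φ : AnalyticOnNhd 𝕜 Φ Φ.source
  analytic_Φ_symm : AnalyticOnNhd 𝕜 Φ.symm Φ.target

namespace SplitDiffeo

variable {𝕜 : Type*} [RCLike 𝕜] {E E' G G' : Type*}
  [NormedAddCommGroup E] [NormedSpace 𝕜 E] [NormedAddCommGroup E'] [NormedSpace 𝕜 E']
  [NormedAddCommGroup G] [NormedSpace 𝕜 G] [NormedAddCommGroup G'] [NormedSpace 𝕜 G']

/-- The domain of definition. -/
def source (H : SplitDiffeo 𝕜 E E' G G') : Set (E × E') := H.F.source ×ˢ H.Φ.source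

/-- The image of the domain of definition. -/
def target (H : SplitDiffeo 𝕜 E E' G G') : Set (G × G') := H.F.target ×ˢ H.Φ.target

/-- The image of the part of `S` that lies in the domain of definition. -/
def image (H : SplitDiffeo 𝕜 E E' G G') (S : Set (E × E')) : Set (G × G') :=
  (fun p => (H.F p.1, H.Φ p.2)) '' (S ∩ H.source)

end SplitDiffeo

/-- `S` is split-equivalent, near its point `q`, to (an open piece of) `T`. -/
def LocallyEquivalentAt (𝕜 : Type*) [RCLike 𝕜] {E E' G G' : Type*}
    [NormedAddCommGroup E] [NormedSpace 𝕜 E] [NormedAddCommGroup E'] [NormedSpace 𝕜 E']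
    [NormedAddCommGroup G] [NormedSpace 𝕜 G] [NormedAddCommGroup G'] [NormedSpace 𝕜 G']
    (S : Set (E × E')) (q : E × E') (T : Set (G × G')) : Prop :=
  ∃ H : SplitDiffeo 𝕜 E E' G G', q ∈ H.source ∧ H.image S = T ∩ H.target

section Graphs

variable {𝕜 : Type*} [RCLike 𝕜] {n m : ℕ}

/-- The product of the line `𝕜¹_var` (here the last coordinate of the space of variables) with a
subset `N` of `𝕜^n × 𝕜^{m+1}`. -/
def prodLineVar (N : Set ((Fin n → 𝕜) × Pt 𝕜 m)) : Set (Pt 𝕜 n × Pt 𝕜 m) :=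
  {p | (p.1.1, p.2) ∈ N}

/-- The product of the line `𝕜¹_par` (here the last coordinate of the space of parameters) with a
subset `N` of `𝕜^{n+1} × 𝕜^m`. -/
def prodLinePar (N : Set (Pt 𝕜 n × (Fin m → 𝕜))) : Set (Pt 𝕜 n × Pt 𝕜 m) :=
  {p | (p.1, p.2.1) ∈ N}

/-- In `U × V`, the set `S` has the equations `y = Q(x, a, b)`, equivalently `b = P(a, x, y)`, with
`Q` and `P` analytic. -/
structure HasGraphEquations (U : Set (Pt 𝕜 n)) (V : Set (Pt 𝕜 m)) (S : Set (Pt 𝕜 n × Pt 𝕜 m))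
    (Q : (Fin n → 𝕜) × Pt 𝕜 m → 𝕜) (P : (Fin m → 𝕜) × Pt 𝕜 n → 𝕜) : Prop where
  isOpen_var : IsOpen U
  isOpen_par : IsOpen V
  analytic_Q : ∀ u ∈ U, ∀ v ∈ V, AnalyticAt 𝕜 Q (u.1, v)
  analytic_P : ∀ u ∈ U, ∀ v ∈ V, AnalyticAt 𝕜 P (v.1, u)
  eq_Q : S = {p | p ∈ U ×ˢ V ∧ p.1.2 = Q (p.1.1, p.2)}
  eq_P : S = {p | p ∈ U ×ˢ V ∧ p.2.2 = P (p.2.1, p.1)}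

/-- Forget the last coordinates: `(x₁, …, xₖ) ↦ (x₁, …, xᵣ)`. -/
def firstCoords {r k : ℕ} (h : r ≤ k) (x : Fin k → 𝕜) : Fin r → 𝕜 := fun i => x (Fin.castLE h i)

/-- `(x₁, …, xₖ, y) ↦ (x₁, …, xᵣ, y)`. -/
def reduce {r k : ℕ} (h : r ≤ k) (p : Pt 𝕜 k) : Pt 𝕜 r := (firstCoords h p.1, p.2)

end Graphs

end ParaCR

/-! For a graphing function `f (x, v)` let K(v) be the space of directions t with ∂_t f(x, v) = 0
for all x in a fixed ball (`paramKernel`). By the identity theorem K(v) is determined by the germ in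
x at any single point. Read off at x = 0, it shows that the coefficient map has rank l + 1 - dim
K(v) at v (`rankAt_coeffMap_add`). Read off at another point, it is the obstruction to finite
nondegeneracy there (`finitelyNondegenerateAt_of_kernel`). Ranks, nondegeneracy and splitting are
thus all statements about K.

Off the zero set of an analytic determinant, dim K has its minimal value l - r
(`exists_generic_rank`). Near such a point K is straightened without integrating a distribution: r +
1 well chosen functions `f (x_i, ·)` are themselves part of a coordinate system, in which K becomes
the span of the superfluous coordinates (`exists_adapted_map`, `exists_isStraightening`). One of
these functions is the distinguished last coordinate, which keeps the new equation solvable for it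
(`exists_transformed`).

This is done for Q in the parameters and for P in the variables, independently, so the change of
coordinates is split. The transformed zero set is insensitive to superfluous parameters by the
equation y = Q, and to superfluous variables by b = P. Hence both new graphing functions may be
replaced by their restrictions to vanishing superfluous coordinates (`exists_reduction`). A
direction that kills the new graphing function pulls back into K
(`mem_tail_of_fderiv_eventually_eq_zero`), so the reduced kernels are zero. This gives finite
nondegeneracy and excludes product structures, since a parameter line factor would produce a nonzero
kernel direction (`not_locallyEquivalentAt_prodLinePar`).

The exceptional set is where the product of the two determinants vanishes on the submanifold. It is
nowhere dense by the identity theorem on a connected graph (`locus_subset_closure`). -/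

namespace ParaCR

open Topology
open scoped ContDiff

/-! ### Iterated and mixed partial derivatives of analytic functions -/

section IteratedDerivatives

variable {𝕜 : Type*} [RCLike 𝕜]
  {X Y G : Type*} [NormedAddCommGroup X] [NormedSpace 𝕜 X] [NormedAddCommGroup Y] [NormedSpace 𝕜 Y]
  [NormedAddCommGroup G] [NormedSpace 𝕜 G]

theorem _root_.AnalyticAt.exists_isOpen_analyticOnNhd {f : X → 𝕜} {x : X} (hf : AnalyticAt 𝕜 f x) :
    ∃ s, IsOpen s ∧ x ∈ s ∧ AnalyticOnNhd 𝕜 f s :=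
  ⟨{y | AnalyticAt 𝕜 f y}, isOpen_analyticAt 𝕜 f, hf, fun _ h => h⟩

theorem analyticAt_iteratedFDeriv {f : X → 𝕜} {x : X} (hf : AnalyticAt 𝕜 f x) (N : ℕ) :
    AnalyticAt 𝕜 (iteratedFDeriv 𝕜 N f) x := by
  obtain ⟨s, hs, hxs, hfs⟩ := hf.exists_isOpen_analyticOnNhd
  exact hfs.iteratedFDeriv N x hxs

theorem iteratedFDeriv_comp_clm_right {f : X → 𝕜} (g : G →L[𝕜] X) {x : G}
    (hf : AnalyticAt 𝕜 f (g x)) (N : ℕ) :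
    iteratedFDeriv 𝕜 N (f ∘ g) x =
      (iteratedFDeriv 𝕜 N f (g x)).compContinuousLinearMap fun _ => g := by
  obtain ⟨s, hs, hxs, hfs⟩ := hf.exists_isOpen_analyticOnNhd
  have hs' : IsOpen (g ⁻¹' s) := hs.preimage g.continuous
  have hfc : ContDiffOn 𝕜 ω f s := fun y hy => (hfs y hy).contDiffAt.contDiffWithinAt
  have h := g.iteratedFDerivWithin_comp_right hfc hs.uniqueDiffOn hs'.uniqueDiffOn hxs
    (i := N) le_top
  rwa [iteratedFDerivWithin_of_isOpen N hs' hxs, iteratedFDerivWithin_of_isOpen N hs hxs] at h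

theorem iteratedFDeriv_slice {f : X × Y → 𝕜} {x : X} {v : Y} (hf : AnalyticAt 𝕜 f (x, v)) (N : ℕ)
    (m : Fin N → X) :
    iteratedFDeriv 𝕜 N (fun x => f (x, v)) x m =
      iteratedFDeriv 𝕜 N f (x, v) (fun t => (m t, 0)) := by
  -- The slice is affine, so it is split into a linear inclusion and a translation, each of which
  -- has a chain rule for iterated derivatives.
  have e : (fun x => f (x, v)) = (fun z => f (z + ((0 : X), v))) ∘ ContinuousLinearMap.inl 𝕜 X Y := by
    funext x; simp
  have hadd : ContinuousLinearMap.inl 𝕜 X Y x + ((0 : X), v) = (x, v) := by simp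
  have hf' : AnalyticAt 𝕜 (fun z => f (z + ((0 : X), v))) (ContinuousLinearMap.inl 𝕜 X Y x) := by
    refine AnalyticAt.fun_comp (g := f) ?_ (by fun_prop)
    rwa [hadd]
  rw [e, iteratedFDeriv_comp_clm_right _ hf', iteratedFDeriv_comp_add_right, hadd]
  rfl

/-- The derivative of an iterated derivative, evaluated on fixed vectors, is the iterated
derivative of the derivative. -/
theorem fderiv_iteratedFDeriv_apply [CompleteSpace X] {f : X → 𝕜} {x : X} (hf : AnalyticAt 𝕜 f x) (N : ℕ)
    (m : Fin N → X) (τ : X) :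
    fderiv 𝕜 (fun y => iteratedFDeriv 𝕜 N f y m) x τ =
      iteratedFDeriv 𝕜 N (fun y => fderiv 𝕜 f y τ) x m := by
  have h1 : fderiv 𝕜 (fun y => iteratedFDeriv 𝕜 N f y m) x τ =
      iteratedFDeriv 𝕜 (N + 1) f x (Fin.cons τ m) := by
    rw [iteratedFDeriv_succ_apply_left]
    have hd : DifferentiableAt 𝕜 (iteratedFDeriv 𝕜 N f) x :=
      (analyticAt_iteratedFDeriv hf N).differentiableAt
    rw [fderiv_continuousMultilinear_apply_const_apply hd]
    simp
  have h2 : iteratedFDeriv 𝕜 N (fun y => fderiv 𝕜 f y τ) x m =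
      iteratedFDeriv 𝕜 (N + 1) f x (Fin.snoc m τ) := by
    rw [iteratedFDeriv_succ_apply_right]
    have e : (fun y => fderiv 𝕜 f y τ) = (ContinuousLinearMap.apply 𝕜 𝕜 τ) ∘ (fderiv 𝕜 f) := rfl
    rw [e, ContinuousLinearMap.iteratedFDeriv_comp_left _ hf.fderiv.contDiffAt (i := N) le_top]
    simp
  rw [h1, h2]
  -- Both sides are the derivative of order `N + 1`, with τ in the first or in the last slot;
  -- symmetry under a cyclic rotation identifies them.
  have h3 := hf.contDiffAt.iteratedFDeriv_comp_perm (Fin.cons τ m) (finRotate (N + 1))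
  rw [← h3, Fin.snoc_eq_cons_rotate]
  rfl

end IteratedDerivatives

section MixedPartials

variable {𝕜 : Type*} [RCLike 𝕜] {k : ℕ} {Y : Type*} [NormedAddCommGroup Y] [NormedSpace 𝕜 Y]

/-- Sorting a word in the coordinate indices yields the block word of a multi-index. With the
symmetry of derivatives, this reduces every derivative along basis vectors to a `mixedPartial`. -/
theorem exists_multiIndex_perm {N : ℕ} (i : Fin N → Fin k) :
    ∃ (β : Fin k → ℕ) (e : Fin N ≃ Fin (∑ j, β j)), ∀ t, (finSigmaFinEquiv.symm (e t)).1 = i t := by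
  classical
  refine ⟨fun j => Fintype.card {t // i t = j},
    ((Equiv.sigmaFiberEquiv i).symm.trans
      (Equiv.sigmaCongrRight fun j => Fintype.equivFin {t // i t = j})).trans finSigmaFinEquiv, ?_⟩
  intro t
  simp [Equiv.sigmaFiberEquiv]

theorem mixedPartial_congr {g h : (Fin k → 𝕜) → 𝕜} {x : Fin k → 𝕜} (e : g =ᶠ[𝓝 x] h)
    (β : Fin k → ℕ) : mixedPartial β g x = mixedPartial β h x := by
  unfold mixedPartial
  rw [(e.iteratedFDeriv 𝕜 _).eq_of_nhds]

/-- A multilinear map is determined on basis vectors, and symmetry reduces these to sorted ones. So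
all iterated derivatives vanish at the point, and the Taylor series, which represents the function
nearby, is zero. -/
theorem eventually_eq_zero_of_mixedPartial {g : (Fin k → 𝕜) → 𝕜} {x : Fin k → 𝕜}
    (hg : AnalyticAt 𝕜 g x) (h : ∀ β, mixedPartial β g x = 0) : ∀ᶠ y in 𝓝 x, g y = 0 := by
  have hz : ∀ N, iteratedFDeriv 𝕜 N g x = 0 := by
    intro N
    apply ContinuousMultilinearMap.toMultilinearMap_injective
    refine Module.Basis.ext_multilinear (fun _ => Pi.basisFun 𝕜 (Fin k)) fun i => ?_
    obtain ⟨β, e, he⟩ := exists_multiIndex_perm i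
    obtain rfl : N = ∑ j, β j := by simpa using Fintype.card_congr e
    have h1 := hg.contDiffAt.iteratedFDeriv_comp_perm
      (fun t => (Pi.single (finSigmaFinEquiv.symm t).1 1 : Fin k → 𝕜)) e
    have h2 := h β
    unfold mixedPartial at h2
    rw [h2] at h1
    simpa [Function.comp_def, he] using h1
  obtain ⟨p, r, hp⟩ := hg
  have hs := fun y hy => hp.hasSum_iteratedFDeriv (y := y) hy
  have hball : Metric.eball x r ∈ 𝓝 x := Metric.eball_mem_nhds x hp.r_pos
  filter_upwards [hball] with y hy
  have h0 := hs (y - x) (by simpa [edist_eq_enorm_sub] using hy)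
  simp only [hz, add_sub_cancel] at h0
  simpa using h0.unique (by simp)

theorem mixedPartial_zero_fun (β : Fin k → ℕ) (x : Fin k → 𝕜) :
    mixedPartial β (fun _ => (0 : 𝕜)) x = 0 := by
  unfold mixedPartial
  have : iteratedFDeriv 𝕜 (∑ i, β i) (fun _ : Fin k → 𝕜 => (0 : 𝕜)) = 0 := iteratedFDeriv_fun_zero
  simp [this]

theorem mixedPartial_slice {f : (Fin k → 𝕜) × Y → 𝕜} {p : (Fin k → 𝕜) × Y}
    (hf : AnalyticAt 𝕜 f p) (β : Fin k → ℕ) :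
    mixedPartial β (fun x => f (x, p.2)) p.1 = iteratedFDeriv 𝕜 (∑ i, β i) f p
      (fun t => (Pi.single (finSigmaFinEquiv.symm t).1 1, 0)) :=
  iteratedFDeriv_slice (x := p.1) (v := p.2) hf _ _

theorem analyticAt_mixedPartial [CompleteSpace Y] {f : (Fin k → 𝕜) × Y → 𝕜} {p : (Fin k → 𝕜) × Y}
    (hf : AnalyticAt 𝕜 f p) (β : Fin k → ℕ) :
    AnalyticAt 𝕜 (fun q : (Fin k → 𝕜) × Y => mixedPartial β (fun x => f (x, q.2)) q.1) p := by
  have h1 := analyticAt_iteratedFDeriv hf (∑ i, β i)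
  have h2 := ((ContinuousMultilinearMap.apply 𝕜 (fun _ : Fin (∑ i, β i) => (Fin k → 𝕜) × Y) 𝕜
    (fun t => (Pi.single (finSigmaFinEquiv.symm t).1 1, 0))).analyticAt _).comp h1
  refine h2.congr ?_
  filter_upwards [hf.eventually_analyticAt] with q hq
  rw [mixedPartial_slice hq]
  rfl

/-- Mixed partials in `x` commute with the derivative in the direction of `v`. -/
theorem fderiv_mixedPartial [CompleteSpace Y] {f : (Fin k → 𝕜) × Y → 𝕜} {p : (Fin k → 𝕜) × Y}
    (hf : AnalyticAt 𝕜 f p) (β : Fin k → ℕ) (τ : (Fin k → 𝕜) × Y) :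
    fderiv 𝕜 (fun q : (Fin k → 𝕜) × Y => mixedPartial β (fun x => f (x, q.2)) q.1) p τ =
      mixedPartial β (fun x => fderiv 𝕜 f (x, p.2) τ) p.1 := by
  have e : (fun q : (Fin k → 𝕜) × Y => mixedPartial β (fun x => f (x, q.2)) q.1) =ᶠ[𝓝 p]
      fun q => iteratedFDeriv 𝕜 (∑ i, β i) f q
      (fun t => (Pi.single (finSigmaFinEquiv.symm t).1 1, 0)) := by
    filter_upwards [hf.eventually_analyticAt] with q hq
    exact mixedPartial_slice hq β
  have hf' : AnalyticAt 𝕜 (fun q => fderiv 𝕜 f q τ) p :=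
    ((ContinuousLinearMap.apply 𝕜 𝕜 τ).analyticAt _).comp hf.fderiv
  rw [e.fderiv_eq, fderiv_iteratedFDeriv_apply hf]
  exact (mixedPartial_slice hf' β).symm

end MixedPartials

/-! ### Kernels, ranks of coefficient maps and finite nondegeneracy -/

section LinearAlgebra

variable {𝕜 : Type*} [RCLike 𝕜] {E : Type*} [NormedAddCommGroup E] [NormedSpace 𝕜 E]
  [FiniteDimensional 𝕜 E]

/-- In finite dimension a span of functionals and its common kernel have complementary dimensions.
The index type is arbitrary because coefficient maps have infinitely many components; this turns
every `rankAt` into the dimension of a kernel. -/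
theorem finrank_span_add_finrank_kernel {ι : Type*} (Λ : ι → E →L[𝕜] 𝕜) (K : Submodule 𝕜 E)
    (hK : ∀ t, t ∈ K ↔ ∀ i, Λ i t = 0) :
    Module.finrank 𝕜 (Submodule.span 𝕜 (Set.range Λ)) + Module.finrank 𝕜 K =
      Module.finrank 𝕜 E := by
  let e : (E →L[𝕜] 𝕜) ≃ₗ[𝕜] Module.Dual 𝕜 E := LinearMap.toContinuousLinearMap.symm
  have h : K = ((Submodule.span 𝕜 (Set.range Λ)).map
      (e : (E →L[𝕜] 𝕜) →ₗ[𝕜] Module.Dual 𝕜 E)).dualCoannihilator := by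
    ext t
    rw [hK, Submodule.mem_dualCoannihilator]
    constructor
    · rintro h _ ⟨φ, hφ, rfl⟩
      change φ t = 0
      induction hφ using Submodule.span_induction with
      | mem x hx => obtain ⟨i, rfl⟩ := hx; exact h i
      | zero => simp
      | add x y _ _ hx hy => simp [hx, hy]
      | smul a x _ hx => simp [hx]
    · intro h i
      exact h _ ⟨Λ i, Submodule.subset_span ⟨i, rfl⟩, rfl⟩
  rw [h, ← Subspace.finrank_add_finrank_dualCoannihilator_eq
    ((Submodule.span 𝕜 (Set.range Λ)).map (e : (E →L[𝕜] 𝕜) →ₗ[𝕜] Module.Dual 𝕜 E)),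
    LinearEquiv.finrank_map_eq]

end LinearAlgebra

section ParamKernel

variable {𝕜 : Type*} [RCLike 𝕜] {X Y : Type*} [NormedAddCommGroup X] [NormedSpace 𝕜 X]
  [NormedAddCommGroup Y] [NormedSpace 𝕜 Y]

/-- The directions `t` in which `f (x, ·)` has zero derivative at `v` for all `x ∈ U`. -/
def paramKernel (f : X × Y → 𝕜) (U : Set X) (v : Y) : Submodule 𝕜 Y where
  carrier := {t | ∀ x ∈ U, fderiv 𝕜 f (x, v) (0, t) = 0}
  add_mem' := by
    intro a b ha hb x hx
    have : ((0 : X), a + b) = (0, a) + (0, b) := by simp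
    rw [this, map_add, ha x hx, hb x hx, add_zero]
  zero_mem' := by
    intro x _
    have : ((0 : X), (0 : Y)) = 0 := rfl
    rw [this, map_zero]
  smul_mem' := by
    intro c a ha x hx
    have : ((0 : X), c • a) = c • (0, a) := by simp
    rw [this, map_smul, ha x hx, smul_zero]

theorem mem_paramKernel {f : X × Y → 𝕜} {U : Set X} {v t : Y} :
    t ∈ paramKernel f U v ↔ ∀ x ∈ U, fderiv 𝕜 f (x, v) (0, t) = 0 := Iff.rfl

theorem analyticAt_fderiv_slice {f : X × Y → 𝕜} {x : X} {v : Y} (hf : AnalyticAt 𝕜 f (x, v))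
    (τ : X × Y) : AnalyticAt 𝕜 (fun x => fderiv 𝕜 f (x, v) τ) x := by
  have h1 : AnalyticAt 𝕜 (fun q => fderiv 𝕜 f q τ) (x, v) :=
    ((ContinuousLinearMap.apply 𝕜 𝕜 τ).analyticAt _).comp hf.fderiv
  exact AnalyticAt.fun_comp (g := fun q => fderiv 𝕜 f q τ) (f := fun x => (x, v)) h1
    (by fun_prop)

/-- By the identity theorem, the kernel can be computed from the germ at any point of `U`. -/
theorem mem_paramKernel_of_eventually {f : X × Y → 𝕜} {U : Set X}
    (hUc : IsPreconnected U) {v : Y} (hf : ∀ x ∈ U, AnalyticAt 𝕜 f (x, v)) {x₀ : X} (hx₀ : x₀ ∈ U)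
    {t : Y} (h : ∀ᶠ x in 𝓝 x₀, fderiv 𝕜 f (x, v) (0, t) = 0) : t ∈ paramKernel f U v := by
  have ha : AnalyticOnNhd 𝕜 (fun x => fderiv 𝕜 f (x, v) (0, t)) U :=
    fun x hx => analyticAt_fderiv_slice (hf x hx) _
  intro x hx
  exact ha.eqOn_zero_of_preconnected_of_eventuallyEq_zero hUc hx₀ h hx

end ParamKernel

section Ranks

variable {𝕜 : Type*} [RCLike 𝕜] {k l : ℕ}

theorem fderiv_coeffMap {f : (Fin k → 𝕜) × Pt 𝕜 l → 𝕜} {v : Pt 𝕜 l}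
    (hf : AnalyticAt 𝕜 f (0, v)) (β : Fin k → ℕ) (t : Pt 𝕜 l) :
    fderiv 𝕜 (coeffMap f β) v t =
      ((∏ i, (β i).factorial : ℕ) : 𝕜)⁻¹ * mixedPartial β (fun x => fderiv 𝕜 f (x, v) (0, t)) 0 := by
  have h1 := analyticAt_mixedPartial hf β
  have h2 : HasFDerivAt (fun w : Pt 𝕜 l => ((0 : Fin k → 𝕜), w))
      (ContinuousLinearMap.inr 𝕜 (Fin k → 𝕜) (Pt 𝕜 l)) v := hasFDerivAt_prodMk_right _ _
  have h3 := (HasFDerivAt.comp v (f := fun w : Pt 𝕜 l => ((0 : Fin k → 𝕜), w))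
    h1.differentiableAt.hasFDerivAt h2).const_mul
    ((∏ i, (β i).factorial : ℕ) : 𝕜)⁻¹
  have h4 : fderiv 𝕜 (coeffMap f β) v = _ := h3.fderiv
  rw [h4]
  have h5 := fderiv_mixedPartial hf β ((0 : Fin k → 𝕜), t)
  simp only [smul_apply, smul_eq_mul, ContinuousLinearMap.comp_apply,
    ContinuousLinearMap.inr_apply]
  rw [h5]

/-- Up to factorials, the differentials of the coefficients in direction t are the derivatives at 0
of x ↦ ∂_t f(x, v). They all vanish exactly when this function vanishes on the connected set `U`, so
the common kernel of the differentials is `paramKernel`. -/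
theorem rankAt_coeffMap_add {f : (Fin k → 𝕜) × Pt 𝕜 l → 𝕜} {U : Set (Fin k → 𝕜)}
    (hUo : IsOpen U) (hUc : IsPreconnected U) (h0 : 0 ∈ U) {v : Pt 𝕜 l}
    (hf : ∀ x ∈ U, AnalyticAt 𝕜 f (x, v)) :
    rankAt (coeffMap f) v + Module.finrank 𝕜 (paramKernel f U v) = l + 1 := by
  have h := finrank_span_add_finrank_kernel (fun β => fderiv 𝕜 (coeffMap f β) v)
    (paramKernel f U v) ?_
  · simpa [rankAt] using h
  intro t
  simp only [fderiv_coeffMap (hf 0 h0)]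
  constructor
  · intro ht β
    have : (fun x => fderiv 𝕜 f (x, v) (0, t)) =ᶠ[𝓝 0] fun _ => 0 := by
      filter_upwards [hUo.mem_nhds h0] with x hx using ht x hx
    rw [mixedPartial_congr this, mixedPartial_zero_fun, mul_zero]
  · intro h
    refine mem_paramKernel_of_eventually hUc hf h0 ?_
    refine eventually_eq_zero_of_mixedPartial (analyticAt_fderiv_slice (hf 0 h0) _) fun β => ?_
    refine (mul_eq_zero.1 (h β)).resolve_left ?_
    exact inv_ne_zero (Nat.cast_ne_zero.2 (Finset.prod_ne_zero_iff.2
      fun i _ => Nat.factorial_ne_zero _))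

/-- The spans of the differentials of the jets of order j increase with j in a finite-dimensional
space, so they stabilise. A vector killed by the stable span has zero x-part, because the x_i are
components of the jet map, and its parameter part t kills the whole Taylor series of ∂_t f at `x₁`.
-/
theorem finitelyNondegenerateAt_of_kernel {f : (Fin k → 𝕜) × Pt 𝕜 l → 𝕜} {x₁ : Fin k → 𝕜}
    {v : Pt 𝕜 l} (hf : AnalyticAt 𝕜 f (x₁, v))
    (h : ∀ t, (∀ᶠ x in 𝓝 x₁, fderiv 𝕜 f (x, v) (0, t) = 0) → t = 0) :
    FinitelyNondegenerateAt f (x₁, v) := by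
  let W : ℕ →o Submodule 𝕜 (((Fin k → 𝕜) × Pt 𝕜 l) →L[𝕜] 𝕜) :=
    { toFun := fun j => Submodule.span 𝕜 (Set.range fun i => fderiv 𝕜 (jetMap j f i) (x₁, v))
      monotone' := by
        intro j j' hj
        refine Submodule.span_mono ?_
        rintro _ ⟨i | β, rfl⟩
        · exact ⟨Sum.inl i, rfl⟩
        · exact ⟨Sum.inr ⟨β.1, β.2.trans hj⟩, rfl⟩ }
  obtain ⟨j, hj⟩ := monotone_stabilizes_iff_noetherian.2 inferInstance W
  refine ⟨j, ?_⟩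
  have hker := finrank_span_add_finrank_kernel (fun i => fderiv 𝕜 (jetMap j f i) (x₁, v)) ⊥ ?_
  · simp only [finrank_bot, add_zero] at hker
    simp only [rankAt]
    rw [hker]
    simp
    ring
  rintro ⟨s, t⟩
  rw [Submodule.mem_bot]
  refine ⟨fun e i => by rw [e, map_zero], fun hz => ?_⟩
  have hW : ∀ φ ∈ W j, φ (s, t) = 0 := by
    intro φ hφ
    induction hφ using Submodule.span_induction with
    | mem x hx => obtain ⟨i, rfl⟩ := hx; exact hz i
    | zero => simp
    | add x y _ _ hx hy => simp [hx, hy]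
    | smul a x _ hx => simp [hx]
  have hs : s = 0 := by
    funext i
    have := hz (Sum.inl i)
    have hd : HasFDerivAt (fun p : (Fin k → 𝕜) × Pt 𝕜 l => p.1 i)
        ((ContinuousLinearMap.proj i).comp (ContinuousLinearMap.fst 𝕜 (Fin k → 𝕜) (Pt 𝕜 l)))
        (x₁, v) :=
      ((ContinuousLinearMap.proj i).comp
        (ContinuousLinearMap.fst 𝕜 (Fin k → 𝕜) (Pt 𝕜 l)) : _ →L[𝕜] 𝕜).hasFDerivAt
    have hd' : fderiv 𝕜 (jetMap j f (Sum.inl i)) (x₁, v) = _ := hd.fderiv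
    rw [hd'] at this
    simpa using this
  subst hs
  have ht : t = 0 := by
    refine h t (eventually_eq_zero_of_mixedPartial (analyticAt_fderiv_slice hf _) fun β => ?_)
    rw [← fderiv_mixedPartial (p := (x₁, v)) hf β (0, t)]
    have hmem : fderiv 𝕜 (jetMap (∑ i, β i) f (Sum.inr ⟨β, le_rfl⟩)) (x₁, v) ∈ W (∑ i, β i) :=
      Submodule.subset_span ⟨_, rfl⟩
    refine hW _ ?_
    -- Orders above j contribute nothing new because the span is already stable at j.
    rcases le_total j (∑ i, β i) with hle | hle
    · rw [hj _ hle]; exact hmem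
    · exact W.monotone hle hmem
  rw [ht]; rfl

end Ranks

/-! ### Forgetting coordinates and extending by zero -/

section Coordinates

variable {𝕜 : Type*} [RCLike 𝕜] {r k : ℕ}

/-- `reduce` as a continuous linear map. -/
def reduceL (𝕜 : Type*) [RCLike 𝕜] {r k : ℕ} (h : r ≤ k) : Pt 𝕜 k →L[𝕜] Pt 𝕜 r :=
  (ContinuousLinearMap.pi fun i =>
    (ContinuousLinearMap.proj (R := 𝕜) (φ := fun _ : Fin k => 𝕜) (Fin.castLE h i)).comp
      (ContinuousLinearMap.fst 𝕜 (Fin k → 𝕜) 𝕜)).prod (ContinuousLinearMap.snd 𝕜 (Fin k → 𝕜) 𝕜)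

theorem reduceL_apply (h : r ≤ k) (p : Pt 𝕜 k) : reduceL 𝕜 h p = reduce h p := rfl

/-- Extension of a vector by zeros. -/
def extendCoords (𝕜 : Type*) [RCLike 𝕜] (r k : ℕ) : (Fin r → 𝕜) →L[𝕜] (Fin k → 𝕜) :=
  ContinuousLinearMap.pi fun i =>
    if h : i.1 < r then ContinuousLinearMap.proj (R := 𝕜) (φ := fun _ : Fin r => 𝕜) ⟨i.1, h⟩ else 0

theorem extendCoords_apply (x : Fin r → 𝕜) (i : Fin k) :
    extendCoords 𝕜 r k x i = if h : i.1 < r then x ⟨i.1, h⟩ else 0 := by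
  simp only [extendCoords, ContinuousLinearMap.pi_apply]
  split_ifs <;> simp

theorem firstCoords_extendCoords (h : r ≤ k) (x : Fin r → 𝕜) :
    firstCoords h (extendCoords 𝕜 r k x) = x := by
  funext i
  simp [firstCoords, extendCoords_apply]

theorem norm_extendCoords_le (x : Fin r → 𝕜) : ‖extendCoords 𝕜 r k x‖ ≤ ‖x‖ := by
  refine (pi_norm_le_iff_of_nonneg (norm_nonneg _)).2 fun i => ?_
  rw [extendCoords_apply]
  split_ifs
  · exact norm_le_pi_norm x _
  · simp

theorem norm_firstCoords_le (h : r ≤ k) (x : Fin k → 𝕜) : ‖firstCoords h x‖ ≤ ‖x‖ :=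
  (pi_norm_le_iff_of_nonneg (norm_nonneg _)).2 fun _ => norm_le_pi_norm x _

/-- Extension by zeros of the first component of a point. -/
def extend (𝕜 : Type*) [RCLike 𝕜] (r k : ℕ) : Pt 𝕜 r →L[𝕜] Pt 𝕜 k :=
  (extendCoords 𝕜 r k).prodMap (ContinuousLinearMap.id 𝕜 𝕜)

theorem extend_apply (p : Pt 𝕜 r) : extend 𝕜 r k p = (extendCoords 𝕜 r k p.1, p.2) := rfl

theorem reduce_extend (h : r ≤ k) (p : Pt 𝕜 r) : reduce h (extend 𝕜 r k p) = p := by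
  simp [reduce, extend_apply, firstCoords_extendCoords]

theorem norm_extend_le (p : Pt 𝕜 r) : ‖extend 𝕜 r k p‖ ≤ ‖p‖ := by
  rw [extend_apply]
  exact max_le_max (norm_extendCoords_le _) le_rfl

theorem norm_reduce_le (h : r ≤ k) (p : Pt 𝕜 k) : ‖reduce h p‖ ≤ ‖p‖ :=
  max_le_max (norm_firstCoords_le h _) le_rfl

/-- For the sup norm, truncation and extension by zero do not increase norms, so a ball projects
exactly onto the ball of the same radius. -/
theorem reduce_image_ball (h : r ≤ k) (ε : ℝ) :
    reduce h '' Metric.ball (0 : Pt 𝕜 k) ε = Metric.ball 0 ε := by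
  ext p
  simp only [Set.mem_image, mem_ball_zero_iff]
  constructor
  · rintro ⟨q, hq, rfl⟩
    exact (norm_reduce_le h q).trans_lt hq
  · exact fun hp => ⟨extend 𝕜 r k p, (norm_extend_le p).trans_lt hp, reduce_extend h p⟩

/-- The space of the coordinates forgotten by `reduce`. -/
def tail (𝕜 : Type*) [RCLike 𝕜] {r k : ℕ} (h : r ≤ k) : Submodule 𝕜 (Pt 𝕜 k) :=
  LinearMap.ker (reduceL 𝕜 h : Pt 𝕜 k →ₗ[𝕜] Pt 𝕜 r)

theorem mem_tail {h : r ≤ k} {p : Pt 𝕜 k} : p ∈ tail 𝕜 h ↔ reduce h p = 0 := Iff.rfl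

theorem finrank_tail (h : r ≤ k) : Module.finrank 𝕜 (tail 𝕜 h) + r = k := by
  have h1 := LinearMap.finrank_range_add_finrank_ker (reduceL 𝕜 h : Pt 𝕜 k →ₗ[𝕜] Pt 𝕜 r)
  have h2 : LinearMap.range (reduceL 𝕜 h : Pt 𝕜 k →ₗ[𝕜] Pt 𝕜 r) = ⊤ :=
    LinearMap.range_eq_top.2 fun p => ⟨extend 𝕜 r k p, reduce_extend h p⟩
  rw [h2, finrank_top] at h1
  simp at h1
  unfold tail
  omega

end Coordinates

/-! ### Adapted coordinates and the generic rank -/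

section Functionals

variable {𝕜 : Type*} [RCLike 𝕜] {E : Type*} [NormedAddCommGroup E] [NormedSpace 𝕜 E]
  [FiniteDimensional 𝕜 E]

/-- A nonzero functional of a set `S` whose span has dimension `r + 1` extends to a linearly
independent family of `j + 1` functionals, the first `r + 1` of which lie in `S`. -/
theorem exists_linearIndependent_functionals {S : Set (E →L[𝕜] 𝕜)} {φ : E →L[𝕜] 𝕜} (hφ : φ ∈ S)
    (hφ0 : φ ≠ 0) {r : ℕ} (hr : Module.finrank 𝕜 (Submodule.span 𝕜 S) = r + 1) (j : ℕ)
    (hj : j + 1 ≤ Module.finrank 𝕜 E) :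
    ∃ w : Fin (j + 1) → E →L[𝕜] 𝕜, w 0 = φ ∧ LinearIndependent 𝕜 w ∧
      ∀ i : Fin (j + 1), i.1 ≤ r → w i ∈ S := by
  induction j with
  | zero =>
    refine ⟨fun _ => φ, rfl, ?_, fun _ _ => hφ⟩
    exact linearIndependent_unique_iff (ι := Fin 1) |>.2 hφ0
  | succ j ih =>
    obtain ⟨w, hw0, hw, hwS⟩ := ih (by omega)
    have hspan : Module.finrank 𝕜 (Submodule.span 𝕜 (Set.range w)) = j + 1 := by
      simpa using finrank_span_eq_card hw
    have hdual : Module.finrank 𝕜 (E →L[𝕜] 𝕜) = Module.finrank 𝕜 E := by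
      have e : (E →L[𝕜] 𝕜) ≃ₗ[𝕜] Module.Dual 𝕜 E := LinearMap.toContinuousLinearMap.symm
      rw [e.finrank_eq, Subspace.dual_finrank_eq]
    have key : ∃ x, x ∉ Submodule.span 𝕜 (Set.range w) ∧ (j + 1 ≤ r → x ∈ S) := by
      by_cases hjr : j + 1 ≤ r
      · by_contra! hcon
        have hle : Submodule.span 𝕜 S ≤ Submodule.span 𝕜 (Set.range w) := by
          refine Submodule.span_le.2 fun x hx => ?_
          by_contra hx'
          exact (hcon x hx').2 hx
        have := Submodule.finrank_mono hle
        omega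
      · have hne : Submodule.span 𝕜 (Set.range w) ≠ ⊤ := by
          intro e
          rw [e, finrank_top] at hspan
          omega
        obtain ⟨x, hx⟩ := SetLike.exists_not_mem_of_ne_top _ hne rfl
        exact ⟨x, hx, fun h => absurd h hjr⟩
    obtain ⟨x, hx, hxS⟩ := key
    refine ⟨Fin.snoc w x, ?_, linearIndependent_finSnoc.2 ⟨hw, hx⟩, ?_⟩
    · rw [← hw0]
      exact Fin.snoc_castSucc (α := fun _ => E →L[𝕜] 𝕜) x w 0
    · intro i hi
      induction i using Fin.lastCases with
      | last => simpa using hxS (by simpa using hi)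
      | cast i => simpa using hwS i (by simpa using hi)

theorem eq_zero_of_linearIndependent_functionals {j : ℕ} {w : Fin j → E →L[𝕜] 𝕜}
    (hw : LinearIndependent 𝕜 w) (hj : Module.finrank 𝕜 E = j) {t : E} (ht : ∀ i, w i t = 0) :
    t = 0 := by
  let K : Submodule 𝕜 E := ⨅ i, LinearMap.ker (w i : E →ₗ[𝕜] 𝕜)
  have hK : ∀ t, t ∈ K ↔ ∀ i, w i t = 0 := fun t => by simp [K]
  have h := finrank_span_add_finrank_kernel w K hK
  have h2 : Module.finrank 𝕜 (Submodule.span 𝕜 (Set.range w)) = j := by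
    simpa using finrank_span_eq_card hw
  have h3 : K = ⊥ := Submodule.finrank_eq_zero.1 (by omega)
  have h4 : t ∈ K := (hK t).2 ht
  rw [h3] at h4
  simpa using h4

end Functionals

section Adapted

variable {𝕜 : Type*} [RCLike 𝕜] {X : Type*} [NormedAddCommGroup X] [NormedSpace 𝕜 X] {l : ℕ}

theorem hasFDerivAt_slice {f : X × Pt 𝕜 l → 𝕜} {x : X} {v : Pt 𝕜 l}
    (hf : AnalyticAt 𝕜 f (x, v)) :
    HasFDerivAt (fun w => f (x, w))
      ((fderiv 𝕜 f (x, v)).comp (ContinuousLinearMap.inr 𝕜 X (Pt 𝕜 l))) v :=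
  HasFDerivAt.comp v (f := fun w : Pt 𝕜 l => (x, w)) hf.differentiableAt.hasFDerivAt
    (hasFDerivAt_prodMk_right _ _)

/-- A map with invertible differential at `v₁`, whose components with index `< r` and whose last
component are functions `f (x, ·)`. -/
theorem exists_adapted_map {f : X × Pt 𝕜 l → 𝕜} {U : Set X} {V : Set (Pt 𝕜 l)}
    (hf : ∀ x ∈ U, ∀ v ∈ V, AnalyticAt 𝕜 f (x, v)) {r : ℕ} (hr : r ≤ l) {v₁ : Pt 𝕜 l}
    (hv₁ : v₁ ∈ V) (hK : Module.finrank 𝕜 (paramKernel f U v₁) + r = l) {x₀ : X} (hx₀ : x₀ ∈ U)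
    (hne : ∃ t, fderiv 𝕜 f (x₀, v₁) (0, t) ≠ 0) :
    ∃ G : Pt 𝕜 l → Pt 𝕜 l, AnalyticOnNhd 𝕜 G V ∧ Function.Injective (fderiv 𝕜 G v₁) ∧
      (∀ v, (G v).2 = f (x₀, v)) ∧
      ∀ v ∈ V, ∀ t ∈ paramKernel f U v, fderiv 𝕜 G v t ∈ tail 𝕜 hr := by
  classical
  let Λ : U → Pt 𝕜 l →L[𝕜] 𝕜 := fun x =>
    (fderiv 𝕜 f (x.1, v₁)).comp (ContinuousLinearMap.inr 𝕜 X (Pt 𝕜 l))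
  have hΛ : ∀ x t, Λ x t = fderiv 𝕜 f (x.1, v₁) (0, t) := fun _ _ => rfl
  have hrank := finrank_span_add_finrank_kernel Λ (paramKernel f U v₁)
    (fun t => by simp [mem_paramKernel, hΛ])
  have hE : Module.finrank 𝕜 (Pt 𝕜 l) = l + 1 := by simp
  -- The slice differentials span a space of dimension r + 1. The one at `x₀` is placed first, to
  -- become the last component of `G`; r further ones come from points of `U`, and arbitrary
  -- functionals complete the family to l + 1.
  obtain ⟨w, hw0, hw, hwS⟩ := exists_linearIndependent_functionals
    (S := Set.range Λ) (φ := Λ ⟨x₀, hx₀⟩) ⟨_, rfl⟩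
    (by rintro e; obtain ⟨t, ht⟩ := hne; exact ht (by rw [← hΛ ⟨x₀, hx₀⟩, e]; simp))
    (r := r) (by omega) l (by omega)
  have hpts : ∀ i : Fin l, ∃ x : U, i.1 < r → Λ x = w i.succ := by
    intro i
    by_cases hi : i.1 < r
    · obtain ⟨x, hx⟩ := hwS i.succ (by simpa using hi)
      exact ⟨x, fun _ => hx⟩
    · exact ⟨⟨x₀, hx₀⟩, fun h => absurd h hi⟩
  choose x hx using hpts
  let c : Fin l → Pt 𝕜 l → 𝕜 := fun i => if i.1 < r then fun v => f ((x i).1, v) else w i.succ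
  have hca : ∀ i, ∀ v ∈ V, AnalyticAt 𝕜 (c i) v := by
    intro i v hv
    simp only [c]
    split_ifs
    · exact AnalyticAt.fun_comp (g := f) (f := fun v => ((x i).1, v)) (hf _ (x i).2 v hv)
        (by fun_prop)
    · exact (w i.succ).analyticAt v
  have h0a : ∀ v ∈ V, AnalyticAt 𝕜 (fun v => f (x₀, v)) v := fun v hv =>
    AnalyticAt.fun_comp (g := f) (f := fun v => (x₀, v)) (hf _ hx₀ v hv) (by fun_prop)
  let G : Pt 𝕜 l → Pt 𝕜 l := fun v => (fun i => c i v, f (x₀, v))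
  have hGd : ∀ v ∈ V, HasFDerivAt G ((ContinuousLinearMap.pi fun i => fderiv 𝕜 (c i) v).prod
      ((fderiv 𝕜 f (x₀, v)).comp (ContinuousLinearMap.inr 𝕜 X (Pt 𝕜 l)))) v := fun v hv =>
    (hasFDerivAt_pi.2 fun i => (hca i v hv).differentiableAt.hasFDerivAt).prodMk
      (hasFDerivAt_slice (hf _ hx₀ v hv))
  have hc1 : ∀ i : Fin l, i.1 < r → ∀ v ∈ V, ∀ t,
      fderiv 𝕜 (c i) v t = fderiv 𝕜 f ((x i).1, v) (0, t) := by
    intro i hi v hv t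
    have : c i = fun v => f ((x i).1, v) := by simp [c, hi]
    rw [this, (hasFDerivAt_slice (hf _ (x i).2 v hv)).fderiv]
    rfl
  have hc2 : ∀ i : Fin l, ¬ i.1 < r → ∀ v, fderiv 𝕜 (c i) v = w i.succ := by
    intro i hi v
    have : c i = w i.succ := by simp [c, hi]
    rw [this, ContinuousLinearMap.fderiv]
  refine ⟨G, ?_, ?_, fun _ => rfl, ?_⟩
  · intro v hv
    exact (AnalyticAt.pi fun i => hca i v hv).prod (h0a v hv)
  · rw [(hGd v₁ hv₁).fderiv]
    refine (injective_iff_map_eq_zero _).2 fun t ht => ?_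
    rw [Prod.ext_iff] at ht
    obtain ⟨ht1, ht2⟩ := ht
    refine eq_zero_of_linearIndependent_functionals hw hE fun i => ?_
    induction i using Fin.cases with
    | zero => rw [hw0, hΛ]; exact ht2
    | succ i =>
      have h1 : fderiv 𝕜 (c i) v₁ t = 0 := congrFun ht1 i
      by_cases hi : i.1 < r
      · rw [hc1 i hi v₁ hv₁] at h1
        rw [← hx i hi, hΛ]
        exact h1
      · rwa [hc2 i hi] at h1
  · intro v hv t ht
    rw [(hGd v hv).fderiv, mem_tail]
    refine Prod.ext (funext fun i => ?_) (ht _ hx₀)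
    change fderiv 𝕜 (c (Fin.castLE hr i)) v t = 0
    rw [hc1 _ (by simp) v hv]
    exact ht _ (x _).2

theorem analyticAt_det {E : Type*} [NormedAddCommGroup E] [NormedSpace 𝕜 E]
    {F : Type*} [NormedAddCommGroup F] [NormedSpace 𝕜 F] [FiniteDimensional 𝕜 F]
    {A : E → F →L[𝕜] F} {v : E} (hA : AnalyticAt 𝕜 A v) :
    AnalyticAt 𝕜 (fun v => LinearMap.det (A v : F →ₗ[𝕜] F)) v := by
  classical
  let b := Module.finBasis 𝕜 F
  have e : (fun v => LinearMap.det (A v : F →ₗ[𝕜] F)) = fun v =>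
      (Matrix.of fun i j => b.coord i (A v (b j))).det := by
    funext v
    rw [← LinearMap.det_toMatrix b]
    congr 1
    ext i j
    simp [LinearMap.toMatrix_apply]
  rw [e]
  simp only [Matrix.det_apply, Matrix.of_apply]
  refine Finset.analyticAt_fun_sum _ fun σ _ => ?_
  refine AnalyticAt.const_smul (f := fun v => ∏ i, b.coord (σ i) (A v (b i)))
    (Finset.analyticAt_fun_prod _ fun i _ => ?_)
  exact (((LinearMap.toContinuousLinearMap (b.coord (σ i))).comp
    (ContinuousLinearMap.apply 𝕜 F (b i))).analyticAt _).comp hA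

theorem det_ne_zero_iff_injective {F : Type*} [AddCommGroup F] [Module 𝕜 F]
    [FiniteDimensional 𝕜 F] (A : F →ₗ[𝕜] F) :
    LinearMap.det A ≠ 0 ↔ Function.Injective A := by
  rw [Ne, LinearMap.det_eq_zero_iff_ker_ne_bot, not_not, LinearMap.ker_eq_bot]

theorem finrank_add_le_of_mapsTo_tail {A : Pt 𝕜 l →L[𝕜] Pt 𝕜 l} (hA : Function.Injective A) {r : ℕ}
    {hr : r ≤ l} {K : Submodule 𝕜 (Pt 𝕜 l)} (hK : ∀ t ∈ K, A t ∈ tail 𝕜 hr) :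
    Module.finrank 𝕜 K + r ≤ l := by
  have h1 : K.map (A : Pt 𝕜 l →ₗ[𝕜] Pt 𝕜 l) ≤ tail 𝕜 hr := by
    rintro _ ⟨t, ht, rfl⟩
    exact hK t ht
  have h2 := Submodule.finrank_mono h1
  rw [← (Submodule.equivMapOfInjective (A : Pt 𝕜 l →ₗ[𝕜] Pt 𝕜 l) hA K).finrank_eq] at h2
  have := finrank_tail (𝕜 := 𝕜) hr
  omega

/-- The image of `K` lies in the tail, and the dimension bound makes it the whole tail; injectivity
then pulls membership back. -/
theorem mem_iff_of_mapsTo_tail {A : Pt 𝕜 l →L[𝕜] Pt 𝕜 l} (hA : Function.Injective A) {r : ℕ}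
    {hr : r ≤ l} {K : Submodule 𝕜 (Pt 𝕜 l)} (hK : ∀ t ∈ K, A t ∈ tail 𝕜 hr)
    (hl : l ≤ Module.finrank 𝕜 K + r) (t : Pt 𝕜 l) : t ∈ K ↔ A t ∈ tail 𝕜 hr := by
  refine ⟨hK t, fun ht => ?_⟩
  have h1 : K.map (A : Pt 𝕜 l →ₗ[𝕜] Pt 𝕜 l) ≤ tail 𝕜 hr := by
    rintro _ ⟨t, ht, rfl⟩
    exact hK t ht
  have h2 : K.map (A : Pt 𝕜 l →ₗ[𝕜] Pt 𝕜 l) = tail 𝕜 hr := by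
    refine Submodule.eq_of_le_of_finrank_le h1 ?_
    rw [← (Submodule.equivMapOfInjective (A : Pt 𝕜 l →ₗ[𝕜] Pt 𝕜 l) hA K).finrank_eq]
    have := finrank_tail (𝕜 := 𝕜) hr
    omega
  rw [← h2] at ht
  obtain ⟨s, hs, hst⟩ := ht
  rwa [← hA hst]

/-- The maximal rank of `v ↦ (f (x, v))_x` is `1 + r`; it is the generic rank of the coefficient
map, and it is attained off the zero set of an analytic function. -/
theorem exists_generic_rank {k : ℕ} {f : (Fin k → 𝕜) × Pt 𝕜 l → 𝕜} {U : Set (Fin k → 𝕜)}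
    {V : Set (Pt 𝕜 l)} (hUo : IsOpen U) (hUc : IsPreconnected U) (hU0 : 0 ∈ U) (hVo : IsOpen V)
    (hVc : IsPreconnected V) (hV0 : 0 ∈ V) (hf : ∀ x ∈ U, ∀ v ∈ V, AnalyticAt 𝕜 f (x, v))
    (hne : ∃ t, fderiv 𝕜 f (0, 0) (0, t) ≠ 0) :
    ∃ r ≤ l, genericRank (coeffMap f) 0 = 1 + r ∧
      (∀ v ∈ V, l ≤ Module.finrank 𝕜 (paramKernel f U v) + r) ∧
      ∃ h : Pt 𝕜 l → 𝕜, AnalyticOnNhd 𝕜 h V ∧ (∃ᶠ v in 𝓝 0, h v ≠ 0) ∧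
        ∀ v ∈ V, h v ≠ 0 → Module.finrank 𝕜 (paramKernel f U v) + r = l := by
  classical
  -- The point `v₁` realises the minimal kernel dimension d over all of `V`; the generic rank will
  -- be 1 + (l - d).
  have hex : ∃ d, ∃ v ∈ V, Module.finrank 𝕜 (paramKernel f U v) = d := ⟨_, 0, hV0, rfl⟩
  obtain ⟨v₁, hv₁, hd⟩ := Nat.find_spec hex
  have hmin : ∀ v ∈ V, Nat.find hex ≤ Module.finrank 𝕜 (paramKernel f U v) :=
    fun v hv => Nat.find_min' hex ⟨v, hv, rfl⟩
  set d := Nat.find hex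
  have hE : Module.finrank 𝕜 (Pt 𝕜 l) = l + 1 := by simp
  have hdl : d ≤ l := by
    have h1 := hmin 0 hV0
    have h2 : Module.finrank 𝕜 (paramKernel f U 0) < l + 1 := by
      rw [← hE]
      refine Submodule.finrank_lt fun e => ?_
      obtain ⟨t, ht⟩ := hne
      have : t ∈ paramKernel f U 0 := by rw [e]; trivial
      exact ht (this 0 hU0)
    omega
  -- Otherwise the kernel at `v₁` would be everything, of dimension l + 1 > d.
  have hx₀ : ∃ x₀ ∈ U, ∃ t, fderiv 𝕜 f (x₀, v₁) (0, t) ≠ 0 := by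
    by_contra! hcon
    have : paramKernel f U v₁ = ⊤ := eq_top_iff.2 fun t _ x hx => hcon x hx t
    rw [this, finrank_top] at hd
    omega
  obtain ⟨x₀, hx₀, hne'⟩ := hx₀
  obtain ⟨G, hGa, hGinj, -, hGK⟩ := exists_adapted_map hf (Nat.sub_le l d) hv₁ (by omega) hx₀ hne'
  let h : Pt 𝕜 l → 𝕜 := fun v => LinearMap.det (fderiv 𝕜 G v : Pt 𝕜 l →ₗ[𝕜] Pt 𝕜 l)
  have hha : AnalyticOnNhd 𝕜 h V := fun v hv => analyticAt_det (hGa v hv).fderiv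
  -- Where the determinant is nonzero, dG embeds the kernel into a tail of dimension d; minimality
  -- of d gives equality.
  have hrank : ∀ v ∈ V, h v ≠ 0 → Module.finrank 𝕜 (paramKernel f U v) + (l - d) = l := by
    intro v hv hhv
    have h1 := finrank_add_le_of_mapsTo_tail
      ((det_ne_zero_iff_injective (fderiv 𝕜 G v : Pt 𝕜 l →ₗ[𝕜] Pt 𝕜 l)).1 hhv) (hGK v hv)
    have := hmin v hv
    omega
  -- If the determinant vanished near 0, it would vanish on the connected set `V`, hence at `v₁`.
  have hfreq : ∃ᶠ v in 𝓝 0, h v ≠ 0 := by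
    intro hcon
    have h1 := hha.eqOn_zero_of_preconnected_of_eventuallyEq_zero hVc hV0
      (by filter_upwards [hcon] with v hv using not_not.1 hv) hv₁
    exact (det_ne_zero_iff_injective (fderiv 𝕜 G v₁ : Pt 𝕜 l →ₗ[𝕜] Pt 𝕜 l)).2 hGinj h1
  refine ⟨l - d, Nat.sub_le l d, ?_, fun v hv => by have := hmin v hv; omega, h, hha, hfreq, hrank⟩
  have hadd : ∀ v ∈ V, rankAt (coeffMap f) v + Module.finrank 𝕜 (paramKernel f U v) = l + 1 :=
    fun v hv => rankAt_coeffMap_add hUo hUc hU0 fun x hx => hf x hx v hv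
  have hVn := hVo.mem_nhds hV0
  -- The upper bound is the minimality of d; the lower bound comes from points with nonzero
  -- determinant arbitrarily close to 0.
  refine le_antisymm (Nat.sInf_le ?_) (le_csInf ⟨1 + (l - d), ?_⟩ ?_)
  · filter_upwards [hVn] with v hv
    have := hadd v hv
    have := hmin v hv
    omega
  · filter_upwards [hVn] with v hv
    have := hadd v hv
    have := hmin v hv
    omega
  · intro r' hr'
    obtain ⟨v, hv, hvV, hvr⟩ := (hfreq.and_eventually (Filter.Eventually.and hVn hr')).exists
    have := hadd v hvV
    have := hrank v hvV hv
    change rankAt (coeffMap f) v ≤ r' at hvr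
    omega

end Adapted

/-! ### Analytic local straightening of the kernels -/

section Straightening

variable {𝕜 : Type*} [RCLike 𝕜]

/-- Restriction of the target of an open partial homeomorphism. -/
def restrTarget {E F : Type*} [TopologicalSpace E] [TopologicalSpace F]
    (Φ : OpenPartialHomeomorph E F) {s : Set F} (hs : IsOpen s) : OpenPartialHomeomorph E F :=
  (Φ.symm.restrOpen s hs).symm

section restrTarget

variable {E F : Type*} [TopologicalSpace E] [TopologicalSpace F]
    (Φ : OpenPartialHomeomorph E F) {s : Set F} (hs : IsOpen s)

theorem restrTarget_symm_apply (y : F) : (restrTarget Φ hs).symm y = Φ.symm y := rfl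

theorem restrTarget_target : (restrTarget Φ hs).target = Φ.target ∩ s := rfl

theorem restrTarget_source_subset : (restrTarget Φ hs).source ⊆ Φ.source := by
  intro x hx
  have h1 := (restrTarget Φ hs).map_source hx
  have h2 := (restrTarget Φ hs).left_inv hx
  rw [← h2]
  exact Φ.map_target h1.1

end restrTarget

theorem exists_analytic_inverse {E : Type*} [NormedAddCommGroup E] [NormedSpace 𝕜 E]
    [FiniteDimensional 𝕜 E] {G : E → E} {V : Set E} (hV : IsOpen V)
    (hG : AnalyticOnNhd 𝕜 G V) {v₀ : E} (hv₀ : v₀ ∈ V) (hinj : Function.Injective (fderiv 𝕜 G v₀)) :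
    ∃ Φ : OpenPartialHomeomorph E E, v₀ ∈ Φ.source ∧ Φ.source ⊆ V ∧ (∀ v, Φ v = G v) ∧
      AnalyticOnNhd 𝕜 Φ.symm Φ.target := by
  have : CompleteSpace E := FiniteDimensional.complete 𝕜 E
  let A : E ≃L[𝕜] E :=
    (LinearEquiv.ofInjectiveEndo (fderiv 𝕜 G v₀ : E →ₗ[𝕜] E) hinj).toContinuousLinearEquiv
  have hA : HasFDerivAt G (A : E →L[𝕜] E) v₀ := (hG v₀ hv₀).differentiableAt.hasFDerivAt
  have hω : (ω : WithTop ℕ∞) ≠ 0 := by simp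
  have hc : ContDiffAt 𝕜 ω G v₀ := (hG v₀ hv₀).contDiffAt
  let Φ₀ := hc.toOpenPartialHomeomorph G hA hω
  have hmem : v₀ ∈ Φ₀.source := hc.mem_toOpenPartialHomeomorph_source hA hω
  have hcoe : ∀ v, Φ₀ v = G v := fun _ => rfl
  -- The inverse function theorem is used for analyticity of the inverse at `G v₀` only. Analyticity
  -- is an open condition, so shrinking the target to this set makes the inverse analytic
  -- throughout.
  let s : Set E := {w | AnalyticAt 𝕜 Φ₀.symm w}
  have hs : IsOpen s := isOpen_analyticAt 𝕜 _
  have h0 : G v₀ ∈ s := (hc.to_localInverse hA hω).analyticAt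
  let Φ₁ := Φ₀.restrOpen V hV
  refine ⟨restrTarget Φ₁ hs, ?_, ?_, fun _ => rfl, ?_⟩
  · have h1 : v₀ ∈ Φ₁.source := ⟨hmem, hv₀⟩
    have h2 : G v₀ ∈ (restrTarget Φ₁ hs).target := ⟨Φ₁.map_source h1, h0⟩
    have h3 := (restrTarget Φ₁ hs).map_target h2
    have h4 : (restrTarget Φ₁ hs).symm (G v₀) = v₀ := Φ₁.left_inv h1
    rwa [h4] at h3
  · exact (restrTarget_source_subset Φ₁ hs).trans Set.inter_subset_right
  · exact fun w hw => hw.2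

theorem fderiv_comp_fderiv_symm {E : Type*} [NormedAddCommGroup E] [NormedSpace 𝕜 E]
    {Φ : OpenPartialHomeomorph E E} (h1 : AnalyticOnNhd 𝕜 Φ Φ.source)
    (h2 : AnalyticOnNhd 𝕜 Φ.symm Φ.target) {w : E} (hw : w ∈ Φ.target) (t : E) :
    fderiv 𝕜 Φ (Φ.symm w) (fderiv 𝕜 Φ.symm w t) = t := by
  have hd := HasFDerivAt.comp w (h1 _ (Φ.map_target hw)).differentiableAt.hasFDerivAt
    (h2 w hw).differentiableAt.hasFDerivAt
  have he : (Φ ∘ Φ.symm) =ᶠ[𝓝 w] id := by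
    filter_upwards [Φ.open_target.mem_nhds hw] with y hy using Φ.right_inv hy
  have := (hd.congr_of_eventuallyEq he.symm).unique (hasFDerivAt_id w)
  exact DFunLike.congr_fun this t

theorem fderiv_symm_comp_fderiv {E : Type*} [NormedAddCommGroup E] [NormedSpace 𝕜 E]
    {Φ : OpenPartialHomeomorph E E} (h1 : AnalyticOnNhd 𝕜 Φ Φ.source)
    (h2 : AnalyticOnNhd 𝕜 Φ.symm Φ.target) {v : E} (hv : v ∈ Φ.source) (t : E) :
    fderiv 𝕜 Φ.symm (Φ v) (fderiv 𝕜 Φ v t) = t := by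
  have := fderiv_comp_fderiv_symm (Φ := Φ.symm) (w := v) h2 h1 hv t
  simpa using this

variable {X : Type*} [NormedAddCommGroup X] [NormedSpace 𝕜 X] {l : ℕ}

/-- Coordinates near `v₀` in which the functions `f (x, ·)`, `x ∈ U`, only depend on the first `r`
coordinates and the last one, the latter being `f (x₀, ·) - f (x₀, v₀)`. -/
structure IsStraightening (f : X × Pt 𝕜 l → 𝕜) (U : Set X) {r : ℕ} (hr : r ≤ l)
    (x₀ : X) (v₀ : Pt 𝕜 l) (Φ : OpenPartialHomeomorph (Pt 𝕜 l) (Pt 𝕜 l)) : Prop where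
  mem_source : v₀ ∈ Φ.source
  map_eq_zero : Φ v₀ = 0
  analytic : AnalyticOnNhd 𝕜 Φ Φ.source
  analytic_symm : AnalyticOnNhd 𝕜 Φ.symm Φ.target
  snd_eq : ∀ v ∈ Φ.source, (Φ v).2 = f (x₀, v) - f (x₀, v₀)
  mem_kernel_iff : ∀ v ∈ Φ.source, ∀ t, t ∈ paramKernel f U v ↔ fderiv 𝕜 Φ v t ∈ tail 𝕜 hr

theorem IsStraightening.restr {f : X × Pt 𝕜 l → 𝕜} {U : Set X} {r : ℕ} {hr : r ≤ l}
    {x₀ : X} {v₀ : Pt 𝕜 l} {Φ : OpenPartialHomeomorph (Pt 𝕜 l) (Pt 𝕜 l)}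
    (h : IsStraightening f U hr x₀ v₀ Φ) {s : Set (Pt 𝕜 l)} (hs : IsOpen s) (h0 : 0 ∈ s) :
    IsStraightening f U hr x₀ v₀ (restrTarget Φ hs) where
  mem_source := by
    have h1 : (0 : Pt 𝕜 l) ∈ (restrTarget Φ hs).target :=
      ⟨h.map_eq_zero ▸ Φ.map_source h.mem_source, h0⟩
    have h2 := (restrTarget Φ hs).map_target h1
    rwa [restrTarget_symm_apply, ← h.map_eq_zero, Φ.left_inv h.mem_source] at h2
  map_eq_zero := h.map_eq_zero
  analytic := fun v hv => h.analytic v (restrTarget_source_subset Φ hs hv)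
  analytic_symm := fun v hv => h.analytic_symm v hv.1
  snd_eq := fun v hv => h.snd_eq v (restrTarget_source_subset Φ hs hv)
  mem_kernel_iff := fun v hv => h.mem_kernel_iff v (restrTarget_source_subset Φ hs hv)

/-- The adapted map, translated to be centred at `v₀`, is a local diffeomorphism sending kernels
into the tail. Since `hVr` bounds the kernel dimension below at every point, the inclusion is an
equality throughout the source and not only at `v₀`. -/
theorem exists_isStraightening {f : X × Pt 𝕜 l → 𝕜} {U : Set X} {V : Set (Pt 𝕜 l)}
    (hV : IsOpen V) (hf : ∀ x ∈ U, ∀ v ∈ V, AnalyticAt 𝕜 f (x, v)) {r : ℕ} (hr : r ≤ l)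
    (hVr : ∀ v ∈ V, l ≤ Module.finrank 𝕜 (paramKernel f U v) + r) {v₀ : Pt 𝕜 l}
    (hv₀ : v₀ ∈ V) (hK : Module.finrank 𝕜 (paramKernel f U v₀) + r = l) {x₀ : X} (hx₀ : x₀ ∈ U)
    (hne : ∃ t, fderiv 𝕜 f (x₀, v₀) (0, t) ≠ 0) :
    ∃ Φ : OpenPartialHomeomorph (Pt 𝕜 l) (Pt 𝕜 l), Φ.source ⊆ V ∧
      IsStraightening f U hr x₀ v₀ Φ := by
  obtain ⟨G, hGa, hGinj, hG2, hGK⟩ := exists_adapted_map hf hr hv₀ hK hx₀ hne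
  have hfd : ∀ v, fderiv 𝕜 (fun v => G v - G v₀) v = fderiv 𝕜 G v := fun v => fderiv_sub_const _
  obtain ⟨Φ, hmem, hsub, hΦ, hΦs⟩ := exists_analytic_inverse (G := fun v => G v - G v₀) hV
    (fun v hv => (hGa v hv).sub analyticAt_const) hv₀ (by rwa [hfd])
  have hΦ' : (Φ : Pt 𝕜 l → Pt 𝕜 l) = fun v => G v - G v₀ := funext hΦ
  have han : AnalyticOnNhd 𝕜 Φ Φ.source := by
    rw [hΦ']
    exact fun v hv => (hGa v (hsub hv)).sub analyticAt_const
  refine ⟨Φ, hsub, hmem, by simp [hΦ], han, hΦs, ?_, ?_⟩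
  · intro v _
    rw [hΦ, Prod.snd_sub, hG2, hG2]
  · intro v hv t
    have hinj : Function.Injective (fderiv 𝕜 Φ v) :=
      Function.LeftInverse.injective (fderiv_symm_comp_fderiv han hΦs hv)
    refine mem_iff_of_mapsTo_tail hinj ?_ (hVr v (hsub hv)) t
    intro t ht
    rw [hΦ', hfd]
    exact hGK v (hsub hv) t ht

end Straightening

/-! ### Kernels of the transformed graphing function -/

section Transformed

variable {𝕜 : Type*} [RCLike 𝕜] {k l : ℕ}

/-- After straightening, the directions in which the new graphing function `f'` is locally constant
are the coordinates that have become superfluous. -/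
theorem mem_tail_of_fderiv_eventually_eq_zero {f f' : (Fin k → 𝕜) × Pt 𝕜 l → 𝕜}
    {U : Set (Fin k → 𝕜)} {V : Set (Pt 𝕜 l)} (hUo : IsOpen U) (hUc : IsPreconnected U)
    (hf : ∀ x ∈ U, ∀ v ∈ V, AnalyticAt 𝕜 f (x, v))
    {F : OpenPartialHomeomorph (Pt 𝕜 k) (Pt 𝕜 k)} (hFs : AnalyticOnNhd 𝕜 F.symm F.target)
    (hFU : ∀ u ∈ F.source, u.1 ∈ U)
    {r : ℕ} {hr : r ≤ l} {x₀ : Fin k → 𝕜} {v₀ : Pt 𝕜 l}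
    {Φ : OpenPartialHomeomorph (Pt 𝕜 l) (Pt 𝕜 l)} (hΦ : IsStraightening f U hr x₀ v₀ Φ)
    (hΦV : Φ.source ⊆ V) (hf' : ∀ u ∈ F.target, ∀ v ∈ Φ.target, AnalyticAt 𝕜 f' (u.1, v))
    (heq : ∀ u ∈ F.target, ∀ v ∈ Φ.target,
      u.2 = f' (u.1, v) ↔ (F.symm u).2 = f ((F.symm u).1, Φ.symm v))
    {u₁ : Pt 𝕜 k} (hu₁ : u₁ ∈ F.target) {v₁ : Pt 𝕜 l} (hv₁ : v₁ ∈ Φ.target)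
    (h₁ : u₁.2 = f' (u₁.1, v₁)) {t : Pt 𝕜 l}
    (ht : ∀ᶠ x in 𝓝 u₁.1, fderiv 𝕜 f' (x, v₁) (0, t) = 0) : t ∈ tail 𝕜 hr := by
  have hw : Φ.symm v₁ ∈ Φ.source := Φ.map_target hv₁
  have hz : F.symm u₁ ∈ F.source := F.map_target hu₁
  suffices hK : fderiv 𝕜 Φ.symm v₁ t ∈ paramKernel f U (Φ.symm v₁) by
    rw [hΦ.mem_kernel_iff _ hw,
      fderiv_comp_fderiv_symm hΦ.analytic hΦ.analytic_symm hv₁] at hK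
    exact hK
  have hfz : (F.symm u₁).2 = f ((F.symm u₁).1, Φ.symm v₁) := (heq u₁ hu₁ v₁ hv₁).1 h₁
  refine mem_paramKernel_of_eventually hUc (fun x hx => hf x hx _ (hΦV hw)) (hFU _ hz) ?_
  -- `F` mixes x and y, so kernels cannot be compared at fixed x. Each x near the base point is
  -- lifted to the leaf y = f(x, ·) of the parameter, and `F` carries this lift to a point `u` of
  -- the transformed leaf.
  have hcont : ContinuousAt (fun x => (x, f (x, Φ.symm v₁))) (F.symm u₁).1 :=
    continuousAt_id.prodMk (ContinuousAt.comp' (f := fun x => (x, Φ.symm v₁))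
      (hf _ (hFU _ hz) _ (hΦV hw)).continuousAt (by fun_prop))
  have hval : ((F.symm u₁).1, f ((F.symm u₁).1, Φ.symm v₁)) = F.symm u₁ := by rw [← hfz]
  have hsrc : ∀ᶠ x in 𝓝 (F.symm u₁).1, (x, f (x, Φ.symm v₁)) ∈ F.source :=
    hcont.eventually_mem (by rw [hval]; exact F.open_source.mem_nhds hz)
  have hγ : Filter.Tendsto (fun x => (F (x, f (x, Φ.symm v₁))).1) (𝓝 (F.symm u₁).1) (𝓝 u₁.1) := by
    have h2 : ContinuousAt F ((F.symm u₁).1, f ((F.symm u₁).1, Φ.symm v₁)) := by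
      rw [hval]; exact F.continuousAt hz
    have h3 := (ContinuousAt.comp' (f := fun x => (x, f (x, Φ.symm v₁))) h2 hcont).fst
    have h4 : (F ((F.symm u₁).1, f ((F.symm u₁).1, Φ.symm v₁))).1 = u₁.1 := by
      rw [hval, F.right_inv hu₁]
    unfold ContinuousAt at h3
    beta_reduce at h3
    rwa [h4] at h3
  filter_upwards [hsrc, hγ.eventually ht, hUo.mem_nhds (hFU _ hz)] with x hxs hxt hxU
  set u := F (x, f (x, Φ.symm v₁)) with hu
  have hut : u ∈ F.target := F.map_source hxs
  have hus : F.symm u = (x, f (x, Φ.symm v₁)) := F.left_inv hxs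
  have hu2 : u.2 = f' (u.1, v₁) := (heq u hut v₁ hv₁).2 (by rw [hus])
  have hline : HasDerivAt (fun s : 𝕜 => v₁ + s • t) t 0 := by
    simpa using ((hasDerivAt_id (0 : 𝕜)).smul_const t).const_add v₁
  have hline0 : v₁ + (0 : 𝕜) • t = v₁ := by simp
  -- Because ∂_t f' vanishes at `u.1`, following the transformed graph over a parameter moving along
  -- t gives zero velocity in the variables at s = 0.
  have hc : HasDerivAt (fun s : 𝕜 => (u.1, f' (u.1, v₁ + s • t))) 0 0 := by
    have h1 : HasDerivAt (fun s : 𝕜 => (u.1, v₁ + s • t)) ((0 : Fin k → 𝕜), t) 0 :=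
      (hasDerivAt_const _ _).prodMk hline
    have h2 := HasFDerivAt.comp_hasDerivAt_of_eq (0 : 𝕜)
      (hf' u hut v₁ hv₁).differentiableAt.hasFDerivAt h1 (by rw [hline0])
    rw [hxt] at h2
    exact (hasDerivAt_const _ _).prodMk h2
  have hc0 : (u.1, f' (u.1, v₁ + (0 : 𝕜) • t)) = u := by rw [hline0, ← hu2]
  have hA : HasDerivAt (fun s : 𝕜 => F.symm (u.1, f' (u.1, v₁ + s • t))) 0 0 := by
    have := HasFDerivAt.comp_hasDerivAt_of_eq (0 : 𝕜)
      (hFs u hut).differentiableAt.hasFDerivAt hc hc0.symm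
    rw [map_zero] at this
    exact this
  have hB : HasDerivAt (fun s : 𝕜 => Φ.symm (v₁ + s • t)) (fderiv 𝕜 Φ.symm v₁ t) 0 :=
    HasFDerivAt.comp_hasDerivAt_of_eq (0 : 𝕜)
      (hΦ.analytic_symm v₁ hv₁).differentiableAt.hasFDerivAt hline hline0.symm
  -- The pulled-back curve satisfies the old equation y = f(x, v). Differentiating at s = 0, only
  -- the parameter term survives, so f has zero derivative at x along the pulled-back direction.
  have hev : (fun s : 𝕜 => (F.symm (u.1, f' (u.1, v₁ + s • t))).2) =ᶠ[𝓝 0]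
      fun s => f ((F.symm (u.1, f' (u.1, v₁ + s • t))).1, Φ.symm (v₁ + s • t)) := by
    have e1 : ∀ᶠ s in 𝓝 (0 : 𝕜), (u.1, f' (u.1, v₁ + s • t)) ∈ F.target :=
      hc.continuousAt.eventually_mem (by rw [hc0]; exact F.open_target.mem_nhds hut)
    have e2 : ∀ᶠ s in 𝓝 (0 : 𝕜), v₁ + s • t ∈ Φ.target :=
      hline.continuousAt.eventually_mem (by rw [hline0]; exact Φ.open_target.mem_nhds hv₁)
    filter_upwards [e1, e2] with s hs1 hs2
    exact (heq _ hs1 _ hs2).1 rfl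
  have hL : HasDerivAt (fun s : 𝕜 => (F.symm (u.1, f' (u.1, v₁ + s • t))).2) 0 0 :=
    (ContinuousLinearMap.snd 𝕜 (Fin k → 𝕜) 𝕜).hasFDerivAt.comp_hasDerivAt (0 : 𝕜) hA
  have hA1 : HasDerivAt (fun s : 𝕜 => (F.symm (u.1, f' (u.1, v₁ + s • t))).1) 0 0 :=
    (ContinuousLinearMap.fst 𝕜 (Fin k → 𝕜) 𝕜).hasFDerivAt.comp_hasDerivAt (0 : 𝕜) hA
  have hR := HasFDerivAt.comp_hasDerivAt_of_eq (0 : 𝕜)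
    (hf x hxU _ (hΦV hw)).differentiableAt.hasFDerivAt (hA1.prodMk hB)
    (by rw [hc0, hus, hline0])
  exact (hR.congr_of_eventuallyEq hev).unique hL

end Transformed

/-! ### Nonexistence of line factors -/

section Products

variable {𝕜 : Type*} [RCLike 𝕜] {k l : ℕ}

/-- In a product with a parameter line, the set of variables attached to a parameter does not change
along the line. Pulled back, Q(x, ·) is constant along a fixed parameter curve for every x near the
base point, so the velocity of that curve lies in the kernel and is zero. But it is the image of a
nonzero vector under the differential of a diffeomorphism. No regularity of `N` is needed. -/
theorem not_locallyEquivalentAt_prodLinePar {Q : (Fin k → 𝕜) × Pt 𝕜 l → 𝕜} {U : Set (Pt 𝕜 k)}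
    {V : Set (Pt 𝕜 l)} (hU : IsOpen U)
    (hQ : ∀ u ∈ U, ∀ v ∈ V, AnalyticAt 𝕜 Q (u.1, v)) {S : Set (Pt 𝕜 k × Pt 𝕜 l)}
    (hS : S = {p | p ∈ U ×ˢ V ∧ p.1.2 = Q (p.1.1, p.2)}) {q : Pt 𝕜 k × Pt 𝕜 l} (hq : q ∈ S)
    (hker : ∀ t, (∀ᶠ x in 𝓝 q.1.1, fderiv 𝕜 Q (x, q.2) (0, t) = 0) → t = 0) :
    ¬ ∃ N : Set (Pt 𝕜 k × (Fin l → 𝕜)), LocallyEquivalentAt 𝕜 S q (prodLinePar N) := by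
  rintro ⟨N, H, hqH, himg⟩
  have hqS := hq
  rw [hS] at hqS
  obtain ⟨⟨hqU, hqV⟩, hqQ⟩ := hqS
  have hq1 : q.1 ∈ H.F.source := hqH.1
  have hq2 : q.2 ∈ H.Φ.source := hqH.2
  set w₀ := H.Φ q.2 with hw₀
  have hw₀t : w₀ ∈ H.Φ.target := H.Φ.map_source hq2
  have hw₀s : H.Φ.symm w₀ = q.2 := H.Φ.left_inv hq2
  let e : Pt 𝕜 l := (0, 1)
  have he : e ≠ 0 := fun h => one_ne_zero (congrArg Prod.snd h)
  have hline : HasDerivAt (fun s : 𝕜 => w₀ + s • e) e 0 := by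
    simpa using ((hasDerivAt_id (0 : 𝕜)).smul_const e).const_add w₀
  have hline0 : w₀ + (0 : 𝕜) • e = w₀ := by simp
  have hc : HasDerivAt (fun s : 𝕜 => H.Φ.symm (w₀ + s • e)) (fderiv 𝕜 H.Φ.symm w₀ e) 0 :=
    HasFDerivAt.comp_hasDerivAt_of_eq (0 : 𝕜)
      (H.analytic_Φ_symm w₀ hw₀t).differentiableAt.hasFDerivAt hline hline0.symm
  have ht0 : fderiv 𝕜 H.Φ.symm w₀ e = 0 := by
    refine hker _ ?_
    have hcont : ContinuousAt (fun x => (x, Q (x, q.2))) q.1.1 :=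
      continuousAt_id.prodMk (ContinuousAt.comp' (f := fun x => (x, q.2))
        (hQ q.1 hqU q.2 hqV).continuousAt (by fun_prop))
    have hval : (q.1.1, Q (q.1.1, q.2)) = q.1 := by rw [← hqQ]
    have hev : ∀ᶠ x in 𝓝 q.1.1, (x, Q (x, q.2)) ∈ H.F.source ∩ U :=
      hcont.eventually_mem (by
        rw [hval]; exact (H.F.open_source.inter hU).mem_nhds ⟨hq1, hqU⟩)
    filter_upwards [hev] with x ⟨hxF, hxU⟩
    have hmem : ((x, Q (x, q.2)), q.2) ∈ S := by
      rw [hS]; exact ⟨⟨hxU, hqV⟩, rfl⟩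
    have hT : (H.F (x, Q (x, q.2)), w₀) ∈ prodLinePar N := by
      have : (H.F (x, Q (x, q.2)), w₀) ∈ H.image S := ⟨_, ⟨hmem, hxF, hq2⟩, rfl⟩
      rw [himg] at this
      exact this.1
    have hconst : (fun s : 𝕜 => Q (x, H.Φ.symm (w₀ + s • e))) =ᶠ[𝓝 0] fun _ => Q (x, q.2) := by
      have e2 : ∀ᶠ s in 𝓝 (0 : 𝕜), w₀ + s • e ∈ H.Φ.target :=
        hline.continuousAt.eventually_mem (by rw [hline0]; exact H.Φ.open_target.mem_nhds hw₀t)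
      filter_upwards [e2] with s hs
      have h1 : (H.F (x, Q (x, q.2)), w₀ + s • e) ∈ prodLinePar N := by
        have e1 : (w₀ + s • e).1 = w₀.1 := by simp [e]
        change (_, (w₀ + s • e).1) ∈ N
        rw [e1]
        exact hT
      have h2 : (H.F (x, Q (x, q.2)), w₀ + s • e) ∈ H.image S := by
        rw [himg]
        exact ⟨h1, H.F.map_source hxF, hs⟩
      obtain ⟨p, ⟨hpS, hpF, hpΦ⟩, hp⟩ := h2
      rw [Prod.ext_iff] at hp
      obtain ⟨hp1, hp2⟩ := hp
      have hp1' : p.1 = (x, Q (x, q.2)) := H.F.injOn hpF hxF hp1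
      have hp2' : p.2 = H.Φ.symm (w₀ + s • e) := by
        have hp2'' : H.Φ p.2 = w₀ + s • e := hp2
        rw [← hp2'', H.Φ.left_inv hpΦ]
      rw [hS] at hpS
      have := hpS.2
      rw [hp1', hp2'] at this
      exact this.symm
    have hd := HasFDerivAt.comp_hasDerivAt_of_eq (0 : 𝕜)
      (hQ _ hxU q.2 hqV).differentiableAt.hasFDerivAt
      ((hasDerivAt_const (0 : 𝕜) x).prodMk hc) (by rw [hline0, hw₀s])
    exact (hd.congr_of_eventuallyEq hconst.symm).unique (hasDerivAt_const _ _)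
  have := fderiv_comp_fderiv_symm H.analytic_Φ H.analytic_Φ_symm hw₀t e
  rw [ht0, map_zero] at this
  exact he this.symm

theorem LocallyEquivalentAt.swap {E E' G G' : Type*}
    [NormedAddCommGroup E] [NormedSpace 𝕜 E] [NormedAddCommGroup E'] [NormedSpace 𝕜 E']
    [NormedAddCommGroup G] [NormedSpace 𝕜 G] [NormedAddCommGroup G'] [NormedSpace 𝕜 G']
    {S : Set (E × E')} {q : E × E'} {T : Set (G × G')} (h : LocallyEquivalentAt 𝕜 S q T) :
    LocallyEquivalentAt 𝕜 (Prod.swap ⁻¹' S) q.swap (Prod.swap ⁻¹' T) := by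
  obtain ⟨H, hq, himg⟩ := h
  refine ⟨⟨H.Φ, H.F, H.analytic_Φ, H.analytic_Φ_symm, H.analytic_F, H.analytic_F_symm⟩,
    ⟨hq.2, hq.1⟩, ?_⟩
  ext ⟨a, b⟩
  have h1 : (b, a) ∈ H.image S ↔ (b, a) ∈ T ∩ H.target := by rw [himg]
  have h2 : (b, a) ∈ T ∩ H.target ↔
      (a, b) ∈ Prod.swap ⁻¹' T ∩ H.Φ.target ×ˢ H.F.target :=
    ⟨fun h => ⟨h.1, h.2.2, h.2.1⟩, fun h => ⟨h.1, h.2.2, h.2.1⟩⟩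
  refine Iff.trans ?_ (h1.trans h2)
  constructor
  · rintro ⟨p, ⟨hpS, hp1, hp2⟩, hp⟩
    rw [Prod.ext_iff] at hp
    exact ⟨p.swap, ⟨hpS, hp2, hp1⟩, Prod.ext hp.2 hp.1⟩
  · rintro ⟨p, ⟨hpS, hp1, hp2⟩, hp⟩
    rw [Prod.ext_iff] at hp
    exact ⟨p.swap, ⟨hpS, hp2, hp1⟩, Prod.ext hp.2 hp.1⟩

theorem not_locallyEquivalentAt_prodLineVar {P : (Fin l → 𝕜) × Pt 𝕜 k → 𝕜} {U : Set (Pt 𝕜 k)}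
    {V : Set (Pt 𝕜 l)} (hV : IsOpen V)
    (hP : ∀ u ∈ U, ∀ v ∈ V, AnalyticAt 𝕜 P (v.1, u)) {S : Set (Pt 𝕜 k × Pt 𝕜 l)}
    (hS : S = {p | p ∈ U ×ˢ V ∧ p.2.2 = P (p.2.1, p.1)}) {q : Pt 𝕜 k × Pt 𝕜 l} (hq : q ∈ S)
    (hker : ∀ t, (∀ᶠ a in 𝓝 q.2.1, fderiv 𝕜 P (a, q.1) (0, t) = 0) → t = 0) :
    ¬ ∃ N : Set ((Fin k → 𝕜) × Pt 𝕜 l), LocallyEquivalentAt 𝕜 S q (prodLineVar N) := by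
  rintro ⟨N, hN⟩
  refine not_locallyEquivalentAt_prodLinePar (Q := P) (S := Prod.swap ⁻¹' S) (q := q.swap) hV
    (fun v hv u hu => hP u hu v hv) ?_ hq hker ⟨Prod.swap ⁻¹' N, hN.swap⟩
  rw [hS]
  ext p
  exact ⟨fun h => ⟨⟨h.1.2, h.1.1⟩, h.2⟩, fun h => ⟨⟨h.1.2, h.1.1⟩, h.2⟩⟩

end Products

/-! ### The two graphed equations on a common ball -/

namespace SolutionSubmanifold

variable {𝕜 : Type*} [RCLike 𝕜] {n m : ℕ}

/-- On the ball of radius `ρ` the submanifold is given by both of its graphed equations. -/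
structure IsGraphRadius (M : SolutionSubmanifold 𝕜 n m) (ρ : ℝ) : Prop where
  pos : 0 < ρ
  analytic : ∀ u ∈ Metric.ball (0 : Pt 𝕜 n) ρ, ∀ v ∈ Metric.ball (0 : Pt 𝕜 m) ρ,
    AnalyticAt 𝕜 M.R (u, v)
  deriv_y_ne : ∀ u ∈ Metric.ball (0 : Pt 𝕜 n) ρ, ∀ v ∈ Metric.ball (0 : Pt 𝕜 m) ρ,
    fderiv 𝕜 M.R (u, v) ((0, 1), 0) ≠ 0
  deriv_b_ne : ∀ u ∈ Metric.ball (0 : Pt 𝕜 n) ρ, ∀ v ∈ Metric.ball (0 : Pt 𝕜 m) ρ,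
    fderiv 𝕜 M.R (u, v) (0, (0, 1)) ≠ 0
  eq_Q : ∀ u ∈ Metric.ball (0 : Pt 𝕜 n) ρ, ∀ v ∈ Metric.ball (0 : Pt 𝕜 m) ρ,
    M.R (u, v) = 0 ↔ u.2 = M.Q (u.1, v)
  eq_P : ∀ u ∈ Metric.ball (0 : Pt 𝕜 n) ρ, ∀ v ∈ Metric.ball (0 : Pt 𝕜 m) ρ,
    M.R (u, v) = 0 ↔ v.2 = M.P (v.1, u)
  analytic_Q : ∀ x ∈ Metric.ball (0 : Fin n → 𝕜) ρ, ∀ v ∈ Metric.ball (0 : Pt 𝕜 m) ρ,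
    AnalyticAt 𝕜 M.Q (x, v)
  analytic_P : ∀ a ∈ Metric.ball (0 : Fin m → 𝕜) ρ, ∀ u ∈ Metric.ball (0 : Pt 𝕜 n) ρ,
    AnalyticAt 𝕜 M.P (a, u)

theorem isGraphingFunction_P (M : SolutionSubmanifold 𝕜 n m) : IsGraphingFunction M.dual.R M.P :=
  M.dual.isGraphingFunction_Q

/-- Every condition holds at all points close to 0, and for the sup norm a product of balls of
radius ρ is a ball of radius ρ. -/
theorem exists_isGraphRadius (M : SolutionSubmanifold 𝕜 n m) {O : Set (Pt 𝕜 n × Pt 𝕜 m)}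
    (hO : O ∈ 𝓝 0) : ∃ ρ, M.IsGraphRadius ρ ∧
      ∀ u ∈ Metric.ball (0 : Pt 𝕜 n) ρ, ∀ v ∈ Metric.ball (0 : Pt 𝕜 m) ρ, (u, v) ∈ O := by
  obtain ⟨hQa, -, hQe⟩ := M.isGraphingFunction_Q
  obtain ⟨hPa, -, hPe⟩ := M.isGraphingFunction_P
  have hfd : ∀ τ, ContinuousAt (fun p => fderiv 𝕜 M.R p τ) 0 := fun τ =>
    (((ContinuousLinearMap.apply 𝕜 𝕜 τ).analyticAt _).comp M.analyticAt.fderiv).continuousAt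
  have t1 : Filter.Tendsto (fun p : Pt 𝕜 n × Pt 𝕜 m => (p.1.1, p.2)) (𝓝 0) (𝓝 0) :=
    Continuous.tendsto' (by fun_prop) _ _ rfl
  have t2 : Filter.Tendsto (fun p : Pt 𝕜 n × Pt 𝕜 m => (p.2.1, p.1)) (𝓝 0) (𝓝 0) :=
    Continuous.tendsto' (by fun_prop) _ _ rfl
  have t3 : Filter.Tendsto (fun p : Pt 𝕜 n × Pt 𝕜 m => p.swap) (𝓝 0) (𝓝 0) :=
    Continuous.tendsto' continuous_swap _ _ rfl
  have hev := M.analyticAt.eventually_analyticAt.and <|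
    ((hfd ((0, 1), 0)).eventually_ne M.deriv_y_ne).and <|
    ((hfd (0, (0, 1))).eventually_ne M.deriv_b_ne).and <| hQe.and <| (t3.eventually hPe).and <|
    (t1.eventually hQa.eventually_analyticAt).and <|
    (t2.eventually hPa.eventually_analyticAt).and (hO : ∀ᶠ p in 𝓝 0, p ∈ O)
  obtain ⟨ρ, hρ, hball⟩ := Metric.eventually_nhds_iff_ball.1 hev
  have hmem : ∀ u ∈ Metric.ball (0 : Pt 𝕜 n) ρ, ∀ v ∈ Metric.ball (0 : Pt 𝕜 m) ρ,
      (u, v) ∈ Metric.ball (0 : Pt 𝕜 n × Pt 𝕜 m) ρ := by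
    intro u hu v hv
    rw [mem_ball_zero_iff] at hu hv ⊢
    exact max_lt hu hv
  have hpt : ∀ {j : ℕ}, ∀ x ∈ Metric.ball (0 : Fin j → 𝕜) ρ,
      (x, (0 : 𝕜)) ∈ Metric.ball (0 : Pt 𝕜 j) ρ := by
    intro j x hx
    rw [mem_ball_zero_iff] at hx ⊢
    exact max_lt hx (by simpa using hρ)
  refine ⟨ρ, ⟨hρ, ?_, ?_, ?_, ?_, ?_, ?_, ?_⟩, ?_⟩
  · exact fun u hu v hv => (hball _ (hmem u hu v hv)).1
  · exact fun u hu v hv => (hball _ (hmem u hu v hv)).2.1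
  · exact fun u hu v hv => (hball _ (hmem u hu v hv)).2.2.1
  · exact fun u hu v hv => (hball _ (hmem u hu v hv)).2.2.2.1
  · exact fun u hu v hv => (hball _ (hmem u hu v hv)).2.2.2.2.1
  · exact fun x hx v hv => (hball _ (hmem _ (hpt x hx) v hv)).2.2.2.2.2.1
  · exact fun a ha u hu => (hball _ (hmem u hu _ (hpt a ha))).2.2.2.2.2.2.1
  · exact fun u hu v hv => (hball _ (hmem u hu v hv)).2.2.2.2.2.2.2

theorem fderiv_dual (M : SolutionSubmanifold 𝕜 n m) (u : Pt 𝕜 n) (v : Pt 𝕜 m) (τ : Pt 𝕜 m × Pt 𝕜 n) :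
    fderiv 𝕜 M.dual.R (v, u) τ = fderiv 𝕜 M.R (u, v) τ.swap := by
  have h : fderiv 𝕜 (fun p : Pt 𝕜 m × Pt 𝕜 n => M.R p.swap) (v, u) =
      (fderiv 𝕜 M.R (u, v)).comp
        (ContinuousLinearEquiv.prodComm 𝕜 (Pt 𝕜 m) (Pt 𝕜 n) : _ →L[𝕜] _) :=
    (ContinuousLinearEquiv.prodComm 𝕜 (Pt 𝕜 m) (Pt 𝕜 n)).comp_right_fderiv (f := M.R) (x := (v, u))
  change fderiv 𝕜 (fun p : Pt 𝕜 m × Pt 𝕜 n => M.R p.swap) (v, u) τ = _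
  rw [h]
  rfl

namespace IsGraphRadius

variable {M : SolutionSubmanifold 𝕜 n m} {ρ : ℝ}

theorem dual (h : M.IsGraphRadius ρ) : M.dual.IsGraphRadius ρ where
  pos := h.pos
  analytic := fun v hv u hu => AnalyticAt.fun_comp (g := M.R) (f := Prod.swap) (x := (v, u))
    (h.analytic u hu v hv) (analyticAt_snd.prod analyticAt_fst)
  deriv_y_ne := fun v hv u hu => by rw [fderiv_dual]; exact h.deriv_b_ne u hu v hv
  deriv_b_ne := fun v hv u hu => by rw [fderiv_dual]; exact h.deriv_y_ne u hu v hv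
  eq_Q := fun v hv u hu => h.eq_P u hu v hv
  eq_P := fun v hv u hu => h.eq_Q u hu v hv
  analytic_Q := h.analytic_P
  analytic_P := h.analytic_Q

theorem fst_mem {j : ℕ} {u : Pt 𝕜 j} (hu : u ∈ Metric.ball (0 : Pt 𝕜 j) ρ) :
    u.1 ∈ Metric.ball (0 : Fin j → 𝕜) ρ := by
  rw [mem_ball_zero_iff] at hu ⊢
  exact (le_max_left _ _).trans_lt hu

/-- Near a point of the submanifold, the points given by the equation `b = P(a, x, y)` lie on it. -/
theorem eventually_R_eq_zero (h : M.IsGraphRadius ρ) {u : Pt 𝕜 n} (hu : u ∈ Metric.ball 0 ρ)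
    {v : Pt 𝕜 m} (hv : v ∈ Metric.ball 0 ρ) (hR : M.R (u, v) = 0) :
    ∀ᶠ u' in 𝓝 u, u' ∈ Metric.ball 0 ρ ∧ (v.1, M.P (v.1, u')) ∈ Metric.ball (0 : Pt 𝕜 m) ρ ∧
      M.R (u', (v.1, M.P (v.1, u'))) = 0 := by
  have hc : ContinuousAt (fun u' : Pt 𝕜 n => (v.1, M.P (v.1, u'))) u :=
    continuousAt_const.prodMk (ContinuousAt.comp' (f := fun u' => (v.1, u'))
      (h.analytic_P _ (fst_mem hv) u hu).continuousAt (by fun_prop))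
  have hval : (v.1, M.P (v.1, u)) = v := by rw [← (h.eq_P u hu v hv).1 hR]
  have h1 : ∀ᶠ u' in 𝓝 u, (v.1, M.P (v.1, u')) ∈ Metric.ball (0 : Pt 𝕜 m) ρ :=
    hc.eventually_mem (by rw [hval]; exact Metric.isOpen_ball.mem_nhds hv)
  filter_upwards [h1, Metric.isOpen_ball.mem_nhds hu] with u' h1 h2
  exact ⟨h2, h1, (h.eq_P u' h2 _ h1).2 rfl⟩

/-- Differentiating R(u', a, P(a, u')) = 0 along τ gives R_u τ + R_b · (P_u τ) = 0, so R_u τ = -R_b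
when P_u τ = 1. -/
theorem fderiv_R_ne_zero (h : M.IsGraphRadius ρ) {u : Pt 𝕜 n} (hu : u ∈ Metric.ball 0 ρ)
    {v : Pt 𝕜 m} (hv : v ∈ Metric.ball 0 ρ) (hR : M.R (u, v) = 0) {τ : Pt 𝕜 n}
    (hτ : fderiv 𝕜 M.P (v.1, u) (0, τ) = 1) : fderiv 𝕜 M.R (u, v) (τ, 0) ≠ 0 := by
  intro h0
  have hval : (v.1, M.P (v.1, u)) = v := by rw [← (h.eq_P u hu v hv).1 hR]
  have hev : (fun u' => M.R (u', (v.1, M.P (v.1, u')))) =ᶠ[𝓝 u] fun _ => 0 := by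
    filter_upwards [h.eventually_R_eq_zero hu hv hR] with u' hu' using hu'.2.2
  have hd1 := hasFDerivAt_slice (h.analytic_P _ (fst_mem hv) u hu)
  have hd2 := (hasFDerivAt_id (𝕜 := 𝕜) u).prodMk ((hasFDerivAt_const v.1 u).prodMk hd1)
  have hd3 := HasFDerivAt.comp u (g := M.R)
    (f := fun u' => (u', (v.1, M.P (v.1, u')))) (g' := fderiv 𝕜 M.R (u, v))
    (by rw [hval]; exact (h.analytic u hu v hv).differentiableAt.hasFDerivAt) hd2
  have hd4 := (hd3.congr_of_eventuallyEq hev.symm).unique (hasFDerivAt_const _ _)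
  have hd5 : fderiv 𝕜 M.R (u, v) (τ, (0, fderiv 𝕜 M.P (v.1, u) (0, τ))) = 0 :=
    DFunLike.congr_fun hd4 τ
  have e : (τ, ((0 : Fin m → 𝕜), (1 : 𝕜))) = (τ, 0) + (0, (0, 1)) := by simp
  rw [hτ, e, map_add, h0, zero_add] at hd5
  exact h.deriv_b_ne u hu v hv hd5

/-- Substituting b = P(a, x, y) gives Q(x, a, P(a, x, y)) = y near the point; the y-derivative of
the left side is 1, so the parameter derivative of Q cannot vanish. -/
theorem fderiv_Q_ne_zero (h : M.IsGraphRadius ρ) {u : Pt 𝕜 n} (hu : u ∈ Metric.ball 0 ρ)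
    {v : Pt 𝕜 m} (hv : v ∈ Metric.ball 0 ρ) (hR : M.R (u, v) = 0) :
    ∃ t, fderiv 𝕜 M.Q (u.1, v) (0, t) ≠ 0 := by
  by_contra! hcon
  have hval : (v.1, M.P (v.1, u)) = v := by rw [← (h.eq_P u hu v hv).1 hR]
  have hev : (fun u' : Pt 𝕜 n => M.Q (u'.1, (v.1, M.P (v.1, u')))) =ᶠ[𝓝 u] fun u' => u'.2 := by
    filter_upwards [h.eventually_R_eq_zero hu hv hR] with u' ⟨h1, h2, h3⟩
    exact ((h.eq_Q u' h1 _ h2).1 h3).symm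
  have hd1 := hasFDerivAt_slice (h.analytic_P _ (fst_mem hv) u hu)
  have hd2 := (ContinuousLinearMap.fst 𝕜 (Fin n → 𝕜) 𝕜).hasFDerivAt (x := u) |>.prodMk
    ((hasFDerivAt_const v.1 u).prodMk hd1)
  have hd3 := HasFDerivAt.comp u (g := M.Q)
    (f := fun u' : Pt 𝕜 n => (u'.1, (v.1, M.P (v.1, u')))) (g' := fderiv 𝕜 M.Q (u.1, v))
    (by rw [hval]; exact (h.analytic_Q _ (fst_mem hu) v hv).differentiableAt.hasFDerivAt) hd2
  have hd4 := (hd3.congr_of_eventuallyEq hev.symm).unique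
    ((ContinuousLinearMap.snd 𝕜 (Fin n → 𝕜) 𝕜).hasFDerivAt (x := u))
  have hd5 : fderiv 𝕜 M.Q (u.1, v) (0, (0, fderiv 𝕜 M.P (v.1, u) (0, (0, 1)))) = 1 :=
    DFunLike.congr_fun hd4 ((0 : Fin n → 𝕜), (1 : 𝕜))
  rw [hcon] at hd5
  exact zero_ne_one hd5

theorem isPreconnected_ball {E : Type*} [NormedAddCommGroup E] [NormedSpace 𝕜 E] (ρ : ℝ) :
    IsPreconnected (Metric.ball (0 : E) ρ) := by
  let _ : NormedSpace ℝ E := NormedSpace.restrictScalars ℝ 𝕜 E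
  exact (convex_ball 0 ρ).isPreconnected

theorem zero_mem_ball {E : Type*} [NormedAddCommGroup E] (h : M.IsGraphRadius ρ) :
    (0 : E) ∈ Metric.ball (0 : E) ρ := Metric.mem_ball_self h.pos

/-- The generic rank of the coefficient map of `Q`. -/
theorem exists_generic_rank (h : M.IsGraphRadius ρ) :
    ∃ r ≤ m, M.genrankPar = 1 + r ∧
      (∀ v ∈ Metric.ball 0 ρ, m ≤ Module.finrank 𝕜 (paramKernel M.Q (Metric.ball 0 ρ) v) + r) ∧
      ∃ g : Pt 𝕜 m → 𝕜, AnalyticOnNhd 𝕜 g (Metric.ball 0 ρ) ∧ (∃ᶠ v in 𝓝 0, g v ≠ 0) ∧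
        ∀ v ∈ Metric.ball 0 ρ, g v ≠ 0 →
          Module.finrank 𝕜 (paramKernel M.Q (Metric.ball 0 ρ) v) + r = m :=
  ParaCR.exists_generic_rank Metric.isOpen_ball (isPreconnected_ball (𝕜 := 𝕜) ρ) h.zero_mem_ball Metric.isOpen_ball
    (isPreconnected_ball (𝕜 := 𝕜) ρ) h.zero_mem_ball h.analytic_Q
    (h.fderiv_Q_ne_zero h.zero_mem_ball h.zero_mem_ball M.map_zero)

end IsGraphRadius

/-- The points with `‖x‖ < δ`, `‖(a, b)‖ < δ` and `|y| < ρ`. -/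
def box (𝕜 : Type*) [RCLike 𝕜] (n m : ℕ) (δ ρ : ℝ) : Set (Pt 𝕜 n × Pt 𝕜 m) :=
  {p | (p.1.1, p.2) ∈ Metric.ball (0 : (Fin n → 𝕜) × Pt 𝕜 m) δ ∧ p.1.2 ∈ Metric.ball (0 : 𝕜) ρ}

theorem isOpen_box (δ ρ : ℝ) : IsOpen (box 𝕜 n m δ ρ) :=
  (Metric.isOpen_ball.preimage (by fun_prop : Continuous fun p : Pt 𝕜 n × Pt 𝕜 m => (p.1.1, p.2))).inter
    (Metric.isOpen_ball.preimage (by fun_prop : Continuous fun p : Pt 𝕜 n × Pt 𝕜 m => p.1.2))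

theorem mem_ball_of_mem_box {δ ρ : ℝ} (hδ : δ ≤ ρ) {p : Pt 𝕜 n × Pt 𝕜 m} (hp : p ∈ box 𝕜 n m δ ρ) :
    p.1 ∈ Metric.ball (0 : Pt 𝕜 n) ρ ∧ p.2 ∈ Metric.ball (0 : Pt 𝕜 m) ρ := by
  obtain ⟨h1, h2⟩ := hp
  rw [mem_ball_zero_iff] at h1 h2
  simp only [mem_ball_zero_iff]
  exact ⟨max_lt (((le_max_left _ _).trans_lt h1).trans_le hδ) h2,
    ((le_max_right _ _).trans_lt h1).trans_le hδ⟩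

/-! ### The admissible domain and the exceptional set -/

namespace IsGraphRadius

variable {M : SolutionSubmanifold 𝕜 n m} {ρ : ℝ}

theorem analyticAt_Q (h : M.IsGraphRadius ρ) {z : (Fin n → 𝕜) × Pt 𝕜 m}
    (hz : z ∈ Metric.ball 0 ρ) : AnalyticAt 𝕜 M.Q z := by
  rw [mem_ball_zero_iff] at hz
  exact h.analytic_Q z.1 (mem_ball_zero_iff.2 ((le_max_left _ _).trans_lt hz)) z.2
    (mem_ball_zero_iff.2 ((le_max_right _ _).trans_lt hz))

/-- Shrinking only (x, a, b) to radius δ keeps Q below the height ρ. The locus in the resulting box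
is then the full graph over a ball, hence connected and parametrised by a connected set on which the
identity theorem applies. -/
theorem exists_box_radius (h : M.IsGraphRadius ρ) :
    ∃ δ, 0 < δ ∧ δ ≤ ρ ∧ ∀ z ∈ Metric.ball (0 : (Fin n → 𝕜) × Pt 𝕜 m) δ,
      M.Q z ∈ Metric.ball (0 : 𝕜) ρ := by
  obtain ⟨hQa, hQ0, -⟩ := M.isGraphingFunction_Q
  have h1 : ∀ᶠ z in 𝓝 0, M.Q z ∈ Metric.ball (0 : 𝕜) ρ :=
    hQa.continuousAt.eventually_mem (by rw [hQ0]; exact Metric.ball_mem_nhds _ h.pos)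
  obtain ⟨δ, hδ, hball⟩ := Metric.eventually_nhds_iff_ball.1 h1
  exact ⟨min δ ρ, lt_min hδ h.pos, min_le_right _ _, fun z hz =>
    hball z (Metric.ball_subset_ball (min_le_left _ _) hz)⟩

variable {δ : ℝ}

theorem locus_box (h : M.IsGraphRadius ρ) (hδρ : δ ≤ ρ)
    (hδ : ∀ z ∈ Metric.ball (0 : (Fin n → 𝕜) × Pt 𝕜 m) δ, M.Q z ∈ Metric.ball (0 : 𝕜) ρ) :
    M.locus (box 𝕜 n m δ ρ) = (fun z : (Fin n → 𝕜) × Pt 𝕜 m => ((z.1, M.Q z), z.2)) ''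
      Metric.ball 0 δ := by
  ext p
  constructor
  · rintro ⟨hp, hR⟩
    refine ⟨(p.1.1, p.2), hp.1, ?_⟩
    have hb := mem_ball_of_mem_box hδρ hp
    have := (h.eq_Q p.1 hb.1 p.2 hb.2).1 hR
    simp only [← this]
  · rintro ⟨z, hz, rfl⟩
    have hp : ((z.1, M.Q z), z.2) ∈ box 𝕜 n m δ ρ := ⟨hz, hδ z hz⟩
    have hb := mem_ball_of_mem_box hδρ hp
    exact ⟨hp, (h.eq_Q _ hb.1 _ hb.2).2 rfl⟩

theorem continuousAt_graph (h : M.IsGraphRadius ρ) {z : (Fin n → 𝕜) × Pt 𝕜 m}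
    (hz : z ∈ Metric.ball 0 ρ) :
    ContinuousAt (fun z : (Fin n → 𝕜) × Pt 𝕜 m => ((z.1, M.Q z), z.2)) z :=
  (continuousAt_fst.prodMk (h.analyticAt_Q hz).continuousAt).prodMk continuousAt_snd

theorem isAdmissibleDomain_box (h : M.IsGraphRadius ρ) (hδ0 : 0 < δ) (hδρ : δ ≤ ρ)
    (hδ : ∀ z ∈ Metric.ball (0 : (Fin n → 𝕜) × Pt 𝕜 m) δ, M.Q z ∈ Metric.ball (0 : 𝕜) ρ) :
    M.IsAdmissibleDomain (box 𝕜 n m δ ρ) where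
  isOpen := isOpen_box δ ρ
  zero_mem := ⟨Metric.mem_ball_self hδ0, Metric.mem_ball_self h.pos⟩
  analytic := fun p hp => h.analytic p.1 (mem_ball_of_mem_box hδρ hp).1 p.2
    (mem_ball_of_mem_box hδρ hp).2
  deriv_y_ne := fun p hp => h.deriv_y_ne p.1 (mem_ball_of_mem_box hδρ hp).1 p.2
    (mem_ball_of_mem_box hδρ hp).2
  deriv_b_ne := fun p hp => h.deriv_b_ne p.1 (mem_ball_of_mem_box hδρ hp).1 p.2
    (mem_ball_of_mem_box hδρ hp).2
  connected := by
    rw [h.locus_box hδρ hδ]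
    refine IsConnected.image ⟨⟨0, Metric.mem_ball_self hδ0⟩, isPreconnected_ball (𝕜 := 𝕜) δ⟩ _ ?_
    exact fun z hz =>
      (h.continuousAt_graph (Metric.ball_subset_ball hδρ hz)).continuousWithinAt

/-- The zero set of a product of nonzero analytic functions of the parameters and of the variables
is a nowhere dense subset of the submanifold. -/
theorem locus_subset_closure (h : M.IsGraphRadius ρ) (hδ0 : 0 < δ) (hδρ : δ ≤ ρ)
    (hδ : ∀ z ∈ Metric.ball (0 : (Fin n → 𝕜) × Pt 𝕜 m) δ, M.Q z ∈ Metric.ball (0 : 𝕜) ρ)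
    {g : Pt 𝕜 m → 𝕜} (hg : AnalyticOnNhd 𝕜 g (Metric.ball 0 ρ)) (hg0 : ∃ᶠ v in 𝓝 0, g v ≠ 0)
    {g' : Pt 𝕜 n → 𝕜} (hg' : AnalyticOnNhd 𝕜 g' (Metric.ball 0 ρ))
    (hg'0 : ∃ᶠ u in 𝓝 0, g' u ≠ 0) :
    M.locus (box 𝕜 n m δ ρ) ⊆ closure (M.locus (box 𝕜 n m δ ρ) \
      {p | p ∈ M.locus (box 𝕜 n m δ ρ) ∧ g p.2 * g' p.1 = 0}) := by
  have hbox : ∀ z ∈ Metric.ball (0 : (Fin n → 𝕜) × Pt 𝕜 m) δ,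
      (z.1, M.Q z) ∈ Metric.ball (0 : Pt 𝕜 n) ρ ∧ z.2 ∈ Metric.ball (0 : Pt 𝕜 m) ρ :=
    fun z hz => mem_ball_of_mem_box (p := ((z.1, M.Q z), z.2)) hδρ ⟨hz, hδ z hz⟩
  have ha : AnalyticOnNhd 𝕜 (fun z : (Fin n → 𝕜) × Pt 𝕜 m => g z.2) (Metric.ball 0 δ) :=
    fun z hz => AnalyticAt.fun_comp (g := g) (hg _ (hbox z hz).2) analyticAt_snd
  have ha' : AnalyticOnNhd 𝕜 (fun z : (Fin n → 𝕜) × Pt 𝕜 m => g' (z.1, M.Q z))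
      (Metric.ball 0 δ) := fun z hz => AnalyticAt.fun_comp (g := g')
    (f := fun z : (Fin n → 𝕜) × Pt 𝕜 m => (z.1, M.Q z)) (hg' _ (hbox z hz).1)
    (analyticAt_fst.prod (h.analyticAt_Q (Metric.ball_subset_ball hδρ hz)))
  have hconn := isPreconnected_ball (𝕜 := 𝕜) (E := (Fin n → 𝕜) × Pt 𝕜 m) δ
  have h0δ : (0 : (Fin n → 𝕜) × Pt 𝕜 m) ∈ Metric.ball 0 δ := Metric.mem_ball_self hδ0
  have hfreq : ∀ z ∈ Metric.ball (0 : (Fin n → 𝕜) × Pt 𝕜 m) δ,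
      ∃ᶠ z' in 𝓝 z, g z'.2 * g' (z'.1, M.Q z') ≠ 0 := by
    intro z hz hcon
    have hzero := (ha.mul ha').eqOn_zero_of_preconnected_of_eventuallyEq_zero hconn hz
      (by filter_upwards [hcon] with z' hz' using not_not.1 hz')
    -- To see that g' is not identically zero on the graph, take u near 0 with g'(u) ≠ 0 and put a =
    -- 0, b = P(0, u): the graph point over (x, 0, b) has variables exactly u.
    have hP := h.eventually_R_eq_zero h.zero_mem_ball h.zero_mem_ball M.map_zero
    have hP0 : M.P 0 = 0 := M.isGraphingFunction_P.2.1
    have hc : ContinuousAt (fun u : Pt 𝕜 n => (u.1, ((0 : Fin m → 𝕜), M.P (0, u)))) 0 :=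
      continuousAt_fst.prodMk (continuousAt_const.prodMk
        (ContinuousAt.comp' (g := M.P) (f := fun u => ((0 : Fin m → 𝕜), u))
          M.isGraphingFunction_P.1.continuousAt (by fun_prop)))
    have hcm : ∀ᶠ u in 𝓝 (0 : Pt 𝕜 n), (u.1, ((0 : Fin m → 𝕜), M.P (0, u))) ∈
        Metric.ball (0 : (Fin n → 𝕜) × Pt 𝕜 m) δ := by
      refine hc.eventually_mem ?_
      have : ((0 : Pt 𝕜 n).1, ((0 : Fin m → 𝕜), M.P (0, 0))) = (0 : (Fin n → 𝕜) × Pt 𝕜 m) := by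
        have e : ((0 : Fin m → 𝕜), (0 : Pt 𝕜 n)) = 0 := rfl
        rw [e, hP0]; rfl
      rw [this]
      exact Metric.ball_mem_nhds _ hδ0
    obtain ⟨u, hu, ⟨hu1, hu2, hu3⟩, hum⟩ := (hg'0.and_eventually (hP.and hcm)).exists
    have huQ := (h.eq_Q u hu1 _ hu2).1 hu3
    have hne : g' (u.1, M.Q (u.1, ((0 : Fin m → 𝕜), M.P (0, u)))) ≠ 0 := by
      have e : (u.1, M.Q (u.1, ((0 : Fin m → 𝕜), M.P (0, u)))) = u := Prod.ext rfl huQ.symm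
      rwa [e]
    -- Near that point g' is nonzero, so g must vanish there, hence on the whole ball, contradicting
    -- that g is nonzero arbitrarily close to 0.
    have hgz : (fun z : (Fin n → 𝕜) × Pt 𝕜 m => g z.2)
        =ᶠ[𝓝 (u.1, ((0 : Fin m → 𝕜), M.P (0, u)))] 0 := by
      filter_upwards [(ha' _ hum).continuousAt.eventually_ne hne,
        Metric.isOpen_ball.mem_nhds hum] with z' h1 h2
      exact (mul_eq_zero.1 (hzero h2)).resolve_right h1
    have hall := ha.eqOn_zero_of_preconnected_of_eventuallyEq_zero hconn hum hgz
    refine hg0 ?_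
    filter_upwards [Metric.ball_mem_nhds (0 : Pt 𝕜 m) hδ0] with v hv
    have hv' : ((0 : Fin n → 𝕜), v) ∈ Metric.ball (0 : (Fin n → 𝕜) × Pt 𝕜 m) δ := by
      rw [mem_ball_zero_iff] at hv ⊢
      exact max_lt (by simpa using hδ0) hv
    exact not_not.2 (hall hv')
  have himg := h.locus_box hδρ hδ
  intro p hp
  rw [himg] at hp
  obtain ⟨z, hz, rfl⟩ := hp
  rw [mem_closure_iff_frequently]
  refine (h.continuousAt_graph (Metric.ball_subset_ball hδρ hz)).tendsto.frequently ?_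
  refine ((hfreq z hz).and_eventually (Metric.isOpen_ball.mem_nhds hz)).mono ?_
  rintro z' ⟨h1, h2⟩
  refine ⟨?_, fun h3 => h1 h3.2⟩
  rw [himg]
  exact ⟨z', h2, rfl⟩

theorem isAnalyticSubset (hδρ : δ ≤ ρ)
    {g : Pt 𝕜 m → 𝕜} (hg : AnalyticOnNhd 𝕜 g (Metric.ball 0 ρ))
    {g' : Pt 𝕜 n → 𝕜} (hg' : AnalyticOnNhd 𝕜 g' (Metric.ball 0 ρ)) :
    IsAnalyticSubset 𝕜 {p | p ∈ M.locus (box 𝕜 n m δ ρ) ∧ g p.2 * g' p.1 = 0}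
      (M.locus (box 𝕜 n m δ ρ)) := by
  refine ⟨fun p hp => hp.1, fun p hp => ⟨box 𝕜 n m δ ρ, isOpen_box δ ρ, hp.1, 1,
    fun _ p => g p.2 * g' p.1, fun _ q hq => ?_, ?_⟩⟩
  · have hb := mem_ball_of_mem_box hδρ hq
    exact (AnalyticAt.fun_comp (g := g) (hg _ hb.2) analyticAt_snd).mul
      (AnalyticAt.fun_comp (g := g') (hg' _ hb.1) analyticAt_fst)
  · ext q
    simp only [Set.mem_inter_iff, Set.mem_ofPred_eq, forall_const]
    tauto

end IsGraphRadius

end SolutionSubmanifold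

/-! ### Independence of the superfluous coordinates and the reduced graph -/

section TailInvariance

variable {𝕜 : Type*} [RCLike 𝕜] {X : Type*} [NormedAddCommGroup X] [NormedSpace 𝕜 X] {r k l : ℕ}

theorem eq_on_ball_of_fderiv_tail_eq_zero {g : Pt 𝕜 l → 𝕜} {ε : ℝ} {hr : r ≤ l}
    (hg : DifferentiableOn 𝕜 g (Metric.ball 0 ε))
    (hg' : ∀ w ∈ Metric.ball (0 : Pt 𝕜 l) ε, ∀ t ∈ tail 𝕜 hr, fderiv 𝕜 g w t = 0)
    {w w' : Pt 𝕜 l} (hw : w ∈ Metric.ball (0 : Pt 𝕜 l) ε) (hw' : w' ∈ Metric.ball (0 : Pt 𝕜 l) ε)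
    (h : reduce hr w = reduce hr w') : g w = g w' := by
  have ht : w' - w ∈ tail 𝕜 hr := by
    rw [mem_tail, ← reduceL_apply, map_sub, reduceL_apply, reduceL_apply, h, sub_self]
  let c : 𝕜 → Pt 𝕜 l := fun s => w + s • (w' - w)
  have hc : ∀ s, HasDerivAt c (w' - w) s := fun s => by
    simpa [c] using ((hasDerivAt_id s).smul_const (w' - w)).const_add w
  have hcc : Continuous c := continuous_iff_continuousAt.2 fun s => (hc s).continuousAt
  -- The 𝕜-line through the two points meets the ball in a convex, hence connected, set of
  -- parameters, on which a vanishing 𝕜-derivative forces constancy.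
  have hT : Convex ℝ (c ⁻¹' Metric.ball 0 ε) := by
    intro s hs s' hs' a b ha hb hab
    have h1 := convex_ball (0 : Pt 𝕜 l) ε hs hs' ha hb hab
    have h2 : a • c s + b • c s' = c (a • s + b • s') := by
      simp only [c, smul_add, add_smul, smul_assoc]
      rw [add_add_add_comm, ← add_smul, hab, one_smul]
    rwa [h2] at h1
  have hopen : IsOpen (c ⁻¹' Metric.ball 0 ε) := Metric.isOpen_ball.preimage hcc
  have hd : ∀ s ∈ c ⁻¹' Metric.ball 0 ε, HasDerivAt (g ∘ c) 0 s := by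
    intro s hs
    have h1 := ((hg (c s) hs).differentiableAt
      (Metric.isOpen_ball.mem_nhds hs)).hasFDerivAt.comp_hasDerivAt s (hc s)
    rwa [hg' (c s) hs _ ht] at h1
  have h0 : c 0 = w := by simp [c]
  have h1 : c 1 = w' := by simp [c]
  have key := hopen.is_const_of_deriv_eq_zero hT.isPreconnected
    (fun s hs => (hd s hs).differentiableAt.differentiableWithinAt) (fun s hs => (hd s hs).deriv)
    (x := 0) (y := 1) (by rw [Set.mem_preimage, h0]; exact hw) (by rw [Set.mem_preimage, h1]; exact hw')
  simpa [h0, h1] using key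

/-- In straightened coordinates the tail directions are kernel directions, so derivatives along them
vanish. A ball as target makes the fibres of `reduce` connected, which turns this infinitesimal
statement into a global one. -/
theorem IsStraightening.eq_of_reduce_eq {f : X × Pt 𝕜 l → 𝕜} {U : Set X} {V : Set (Pt 𝕜 l)}
    (hf : ∀ x ∈ U, ∀ v ∈ V, AnalyticAt 𝕜 f (x, v)) {hr : r ≤ l} {x₀ : X} {v₀ : Pt 𝕜 l}
    {Φ : OpenPartialHomeomorph (Pt 𝕜 l) (Pt 𝕜 l)} (hΦ : IsStraightening f U hr x₀ v₀ Φ)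
    (hΦV : Φ.source ⊆ V) {ε : ℝ} (hε : Φ.target = Metric.ball 0 ε) {w w' : Pt 𝕜 l}
    (hw : w ∈ Φ.target) (hw' : w' ∈ Φ.target) (h : reduce hr w = reduce hr w') {x : X}
    (hx : x ∈ U) : f (x, Φ.symm w) = f (x, Φ.symm w') := by
  have hd : ∀ w ∈ Φ.target, HasFDerivAt (fun w => f (x, Φ.symm w))
      (((fderiv 𝕜 f (x, Φ.symm w)).comp (ContinuousLinearMap.inr 𝕜 X (Pt 𝕜 l))).comp
        (fderiv 𝕜 Φ.symm w)) w := fun w hw =>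
    HasFDerivAt.comp w (g := fun v => f (x, v))
      (hasFDerivAt_slice (hf x hx _ (hΦV (Φ.map_target hw))))
      (hΦ.analytic_symm w hw).differentiableAt.hasFDerivAt
  rw [hε] at hd hw hw'
  refine eq_on_ball_of_fderiv_tail_eq_zero (g := fun w => f (x, Φ.symm w))
    (fun w hw => (hd w hw).differentiableAt.differentiableWithinAt) ?_ hw hw' h
  intro w hw t ht
  rw [(hd w hw).fderiv]
  rw [← hε] at hw
  have hK : fderiv 𝕜 Φ.symm w t ∈ paramKernel f U (Φ.symm w) := by
    rw [hΦ.mem_kernel_iff _ (Φ.map_target hw),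
      fderiv_comp_fderiv_symm hΦ.analytic hΦ.analytic_symm hw]
    exact ht
  exact hK x hx

end TailInvariance

section Reduced

variable {𝕜 : Type*} [RCLike 𝕜] {r s k l : ℕ}

/-- `firstCoords` as a continuous linear map. -/
def firstCoordsL (𝕜 : Type*) [RCLike 𝕜] {r k : ℕ} (h : r ≤ k) : (Fin k → 𝕜) →L[𝕜] (Fin r → 𝕜) :=
  ContinuousLinearMap.pi fun i =>
    ContinuousLinearMap.proj (R := 𝕜) (φ := fun _ : Fin k => 𝕜) (Fin.castLE h i)

theorem firstCoordsL_apply (h : r ≤ k) (x : Fin k → 𝕜) : firstCoordsL 𝕜 h x = firstCoords h x := rfl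

/-- The graphing function in the remaining coordinates has trivial parameter kernels. -/
theorem eq_zero_of_reduced_fderiv_eq_zero {f : (Fin k → 𝕜) × Pt 𝕜 l → 𝕜}
    {U : Set (Fin k → 𝕜)} {V : Set (Pt 𝕜 l)} (hUo : IsOpen U) (hUc : IsPreconnected U)
    (hf : ∀ x ∈ U, ∀ v ∈ V, AnalyticAt 𝕜 f (x, v))
    {F : OpenPartialHomeomorph (Pt 𝕜 k) (Pt 𝕜 k)} (hFs : AnalyticOnNhd 𝕜 F.symm F.target)
    (hFU : ∀ u ∈ F.source, u.1 ∈ U) {hs : s ≤ k}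
    {hr : r ≤ l} {x₀ : Fin k → 𝕜} {v₀ : Pt 𝕜 l}
    {Φ : OpenPartialHomeomorph (Pt 𝕜 l) (Pt 𝕜 l)} (hΦ : IsStraightening f U hr x₀ v₀ Φ)
    (hΦV : Φ.source ⊆ V) {ε : ℝ} (hFε : F.target = Metric.ball 0 ε)
    (hΦε : Φ.target = Metric.ball 0 ε) {fr : (Fin s → 𝕜) × Pt 𝕜 r → 𝕜}
    (hfr : ∀ u ∈ Metric.ball (0 : Pt 𝕜 s) ε, ∀ v ∈ Metric.ball (0 : Pt 𝕜 r) ε,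
      AnalyticAt 𝕜 fr (u.1, v))
    (heq : ∀ u ∈ F.target, ∀ v ∈ Φ.target,
      u.2 = fr (firstCoords hs u.1, reduce hr v) ↔
        (F.symm u).2 = f ((F.symm u).1, Φ.symm v))
    {u : Pt 𝕜 s} (hu : u ∈ Metric.ball 0 ε) {v : Pt 𝕜 r} (hv : v ∈ Metric.ball 0 ε)
    (huv : u.2 = fr (u.1, v)) {t : Pt 𝕜 r}
    (ht : ∀ᶠ x in 𝓝 u.1, fderiv 𝕜 fr (x, v) (0, t) = 0) : t = 0 := by
  have hext : ∀ {i j : ℕ} {p : Pt 𝕜 i}, p ∈ Metric.ball 0 ε → extend 𝕜 i j p ∈ Metric.ball 0 ε := by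
    intro i j p hp
    rw [mem_ball_zero_iff] at hp ⊢
    exact (norm_extend_le p).trans_lt hp
  have hred : ∀ {i j : ℕ} (h : i ≤ j) {p : Pt 𝕜 j}, p ∈ Metric.ball 0 ε →
      reduce h p ∈ Metric.ball 0 ε := by
    intro i j h p hp
    rw [mem_ball_zero_iff] at hp ⊢
    exact (norm_reduce_le h p).trans_lt hp
  let A : (Fin k → 𝕜) × Pt 𝕜 l →L[𝕜] (Fin s → 𝕜) × Pt 𝕜 r :=
    (firstCoordsL 𝕜 hs).prodMap (reduceL 𝕜 hr)
  have hA : ∀ x v, A (x, v) = (firstCoords hs x, reduce hr v) := fun _ _ => rfl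
  -- The reduced function is pulled back to the full space. The zero extension of t is then a tail
  -- vector, and truncating it back gives t = 0.
  have hmem : extend 𝕜 r l t ∈ tail 𝕜 hr := by
    refine mem_tail_of_fderiv_eventually_eq_zero (f' := fr ∘ A) (u₁ := extend 𝕜 s k u)
      (v₁ := extend 𝕜 r l v) hUo hUc hf hFs hFU hΦ hΦV ?_ heq ?_ ?_ ?_ ?_
    · intro u hu v hv
      rw [hFε] at hu
      rw [hΦε] at hv
      exact AnalyticAt.comp (g := fr) (f := A) (hfr _ (hred hs hu) _ (hred hr hv))
        (A.analyticAt _)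
    · rw [hFε]; exact hext hu
    · rw [hΦε]; exact hext hv
    · change u.2 = fr (firstCoords hs (extendCoords 𝕜 s k u.1), reduce hr (extend 𝕜 r l v))
      rw [reduce_extend, firstCoords_extendCoords]
      exact huv
    · have hx1 : Filter.Tendsto (firstCoords hs) (𝓝 (extend 𝕜 s k u).1) (𝓝 u.1) := by
        have := (firstCoordsL 𝕜 hs).continuous.tendsto (extend 𝕜 s k u).1
        simp only [extend_apply, firstCoordsL_apply, firstCoords_extendCoords] at this
        exact this
      have hball : ∀ᶠ x in 𝓝 u.1, (x, u.2) ∈ Metric.ball (0 : Pt 𝕜 s) ε :=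
        (by fun_prop : ContinuousAt (fun x => (x, u.2)) u.1).eventually_mem
          (Metric.isOpen_ball.mem_nhds hu)
      filter_upwards [hx1.eventually ht, hx1.eventually hball] with x hx hxb
      have hAx : A (x, extend 𝕜 r l v) = (firstCoords hs x, v) := by
        rw [hA, reduce_extend]
      have hd : HasFDerivAt (fr ∘ A) ((fderiv 𝕜 fr (firstCoords hs x, v)).comp A)
          (x, extend 𝕜 r l v) := by
        refine HasFDerivAt.comp _ ?_ A.hasFDerivAt
        rw [hAx]
        exact (hfr _ hxb v hv).differentiableAt.hasFDerivAt
      rw [hd.fderiv, ContinuousLinearMap.comp_apply, hA, reduce_extend]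
      exact hx
  rwa [mem_tail, reduce_extend] at hmem

end Reduced

/-! ### The submanifold in straightened coordinates -/

section Centering

variable {𝕜 : Type*} [RCLike 𝕜] {X : Type*} [NormedAddCommGroup X] [NormedSpace 𝕜 X] {r l : ℕ}

theorem IsStraightening.zero_mem_target {f : X × Pt 𝕜 l → 𝕜} {U : Set X} {hr : r ≤ l}
    {x₀ : X} {v₀ : Pt 𝕜 l} {Φ : OpenPartialHomeomorph (Pt 𝕜 l) (Pt 𝕜 l)}
    (h : IsStraightening f U hr x₀ v₀ Φ) : 0 ∈ Φ.target :=
  h.map_eq_zero ▸ Φ.map_source h.mem_source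

theorem IsStraightening.symm_zero {f : X × Pt 𝕜 l → 𝕜} {U : Set X} {hr : r ≤ l}
    {x₀ : X} {v₀ : Pt 𝕜 l} {Φ : OpenPartialHomeomorph (Pt 𝕜 l) (Pt 𝕜 l)}
    (h : IsStraightening f U hr x₀ v₀ Φ) : Φ.symm 0 = v₀ := by
  rw [← h.map_eq_zero, Φ.left_inv h.mem_source]

/-- The last coordinate vector is a direction in which `f (x₀, ·)` has derivative `1`. -/
theorem IsStraightening.fderiv_apply_last {f : X × Pt 𝕜 l → 𝕜} {U : Set X} {hr : r ≤ l}
    {x₀ : X} {v₀ : Pt 𝕜 l} {Φ : OpenPartialHomeomorph (Pt 𝕜 l) (Pt 𝕜 l)}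
    (h : IsStraightening f U hr x₀ v₀ Φ) (hf : AnalyticAt 𝕜 f (x₀, v₀)) :
    fderiv 𝕜 f (x₀, v₀) (0, fderiv 𝕜 Φ.symm 0 (0, 1)) = 1 := by
  have hd1 : HasFDerivAt (fun w => f (x₀, Φ.symm w) - f (x₀, v₀))
      (((fderiv 𝕜 f (x₀, v₀)).comp (ContinuousLinearMap.inr 𝕜 X (Pt 𝕜 l))).comp
        (fderiv 𝕜 Φ.symm 0)) 0 := by
    refine HasFDerivAt.sub_const _ (HasFDerivAt.comp 0 (g := fun v => f (x₀, v)) ?_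
      (h.analytic_symm 0 h.zero_mem_target).differentiableAt.hasFDerivAt)
    rw [h.symm_zero]
    exact hasFDerivAt_slice hf
  have hev : (fun w : Pt 𝕜 l => w.2) =ᶠ[𝓝 0] fun w => f (x₀, Φ.symm w) - f (x₀, v₀) := by
    filter_upwards [Φ.open_target.mem_nhds h.zero_mem_target] with w hw
    rw [← h.snd_eq _ (Φ.map_target hw), Φ.right_inv hw]
  have hd2 := (hd1.congr_of_eventuallyEq hev).unique
    ((ContinuousLinearMap.snd 𝕜 (Fin l → 𝕜) 𝕜).hasFDerivAt (x := 0))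
  exact DFunLike.congr_fun hd2 ((0 : Fin l → 𝕜), (1 : 𝕜))

end Centering

namespace SolutionSubmanifold.IsGraphRadius

variable {𝕜 : Type*} [RCLike 𝕜] {n m : ℕ} {M : SolutionSubmanifold 𝕜 n m} {ρ : ℝ}

/-- The submanifold in straightened coordinates. -/
theorem exists_transformed (h : M.IsGraphRadius ρ) {u₀ : Pt 𝕜 n} (hu₀ : u₀ ∈ Metric.ball 0 ρ)
    {v₀ : Pt 𝕜 m} (hv₀ : v₀ ∈ Metric.ball 0 ρ) (hR : M.R (u₀, v₀) = 0) {nM mM : ℕ} {hn : nM ≤ n}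
    {hm : mM ≤ m} {F : OpenPartialHomeomorph (Pt 𝕜 n) (Pt 𝕜 n)}
    {Φ : OpenPartialHomeomorph (Pt 𝕜 m) (Pt 𝕜 m)}
    (hF : IsStraightening M.P (Metric.ball 0 ρ) hn v₀.1 u₀ F)
    (hΦ : IsStraightening M.Q (Metric.ball 0 ρ) hm u₀.1 v₀ Φ) :
    ∃ M' : SolutionSubmanifold 𝕜 n m, ∀ u v, M'.R (u, v) = M.R (F.symm u, Φ.symm v) := by
  have hT : AnalyticAt 𝕜 (fun p : Pt 𝕜 n × Pt 𝕜 m => (F.symm p.1, Φ.symm p.2)) 0 :=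
    (AnalyticAt.fun_comp (g := F.symm) (f := Prod.fst) (x := (0 : Pt 𝕜 n × Pt 𝕜 m))
      (hF.analytic_symm 0 hF.zero_mem_target) analyticAt_fst).prod
    (AnalyticAt.fun_comp (g := Φ.symm) (f := Prod.snd) (x := (0 : Pt 𝕜 n × Pt 𝕜 m))
      (hΦ.analytic_symm 0 hΦ.zero_mem_target) analyticAt_snd)
  have hT0 : (F.symm (0 : Pt 𝕜 n × Pt 𝕜 m).1, Φ.symm (0 : Pt 𝕜 n × Pt 𝕜 m).2) = (u₀, v₀) :=
    Prod.ext hF.symm_zero hΦ.symm_zero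
  have hRa := h.analytic u₀ hu₀ v₀ hv₀
  have hd : HasFDerivAt (fun p : Pt 𝕜 n × Pt 𝕜 m => M.R (F.symm p.1, Φ.symm p.2))
      ((fderiv 𝕜 M.R (u₀, v₀)).comp ((fderiv 𝕜 F.symm 0).prodMap (fderiv 𝕜 Φ.symm 0))) 0 := by
    refine HasFDerivAt.comp (0 : Pt 𝕜 n × Pt 𝕜 m) (g := M.R)
      (f := fun p : Pt 𝕜 n × Pt 𝕜 m => (F.symm p.1, Φ.symm p.2)) ?_ ?_
    · rw [hT0]; exact hRa.differentiableAt.hasFDerivAt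
    · exact HasFDerivAt.prodMap (0 : Pt 𝕜 n × Pt 𝕜 m)
        (hF.analytic_symm 0 hF.zero_mem_target).differentiableAt.hasFDerivAt
        (hΦ.analytic_symm 0 hΦ.zero_mem_target).differentiableAt.hasFDerivAt
  refine ⟨⟨fun p => M.R (F.symm p.1, Φ.symm p.2), ?_, ?_, ?_, ?_⟩, fun _ _ => rfl⟩
  · refine AnalyticAt.fun_comp (g := M.R) ?_ hT
    rw [hT0]; exact hRa
  · rw [hT0]; exact hR
  · rw [hd.fderiv]
    -- Here y' is P(a₀, ·) up to a constant, so the y'-direction pulls back to a vector along which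
    -- P(a₀, ·) has derivative 1; such a vector is transverse to R = 0.
    have h1 := h.fderiv_R_ne_zero hu₀ hv₀ hR
      (hF.fderiv_apply_last (h.analytic_P _ (fst_mem hv₀) u₀ hu₀))
    simpa using h1
  · rw [hd.fderiv]
    have h1 := h.dual.fderiv_R_ne_zero hv₀ hu₀ hR
      (hΦ.fderiv_apply_last (h.analytic_Q _ (fst_mem hu₀) v₀ hv₀))
    rw [fderiv_dual] at h1
    simpa using h1

end SolutionSubmanifold.IsGraphRadius

/-! ### Reduction at a point of maximal ranks -/

section Balls

variable {𝕜 : Type*} [RCLike 𝕜] {r k : ℕ} {ε : ℝ}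

theorem extend_mem_ball {p : Pt 𝕜 r} (hp : p ∈ Metric.ball 0 ε) :
    extend 𝕜 r k p ∈ Metric.ball 0 ε := by
  rw [mem_ball_zero_iff] at hp ⊢
  exact (norm_extend_le p).trans_lt hp

theorem reduce_mem_ball (h : r ≤ k) {p : Pt 𝕜 k} (hp : p ∈ Metric.ball 0 ε) :
    reduce h p ∈ Metric.ball 0 ε := by
  rw [mem_ball_zero_iff] at hp ⊢
  exact (norm_reduce_le h p).trans_lt hp

theorem restrTarget_target_of_subset {E : Type*} [TopologicalSpace E]
    (Φ : OpenPartialHomeomorph E E) {s : Set E} (hs : IsOpen s) (h : s ⊆ Φ.target) :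
    (restrTarget Φ hs).target = s := by
  rw [restrTarget_target]
  exact Set.inter_eq_right.2 h

end Balls

section Model

variable {𝕜 : Type*} [RCLike 𝕜] {n m nM mM : ℕ}

/-- The graphing function in the first coordinates, the others being set to zero. -/
def restrictGraph (f : (Fin n → 𝕜) × Pt 𝕜 m → 𝕜) (nM mM : ℕ) : (Fin nM → 𝕜) × Pt 𝕜 mM → 𝕜 :=
  fun z => f (extendCoords 𝕜 nM n z.1, extend 𝕜 mM m z.2)

theorem analyticAt_restrictGraph {f : (Fin n → 𝕜) × Pt 𝕜 m → 𝕜} {ε : ℝ}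
    (hf : ∀ x ∈ Metric.ball (0 : Fin n → 𝕜) ε, ∀ v ∈ Metric.ball (0 : Pt 𝕜 m) ε,
      AnalyticAt 𝕜 f (x, v))
    {u : Pt 𝕜 nM} (hu : u ∈ Metric.ball 0 ε) {v : Pt 𝕜 mM} (hv : v ∈ Metric.ball 0 ε) :
    AnalyticAt 𝕜 (restrictGraph f nM mM) (u.1, v) := by
  let A : (Fin nM → 𝕜) × Pt 𝕜 mM →L[𝕜] (Fin n → 𝕜) × Pt 𝕜 m :=
    (extendCoords 𝕜 nM n).prodMap (extend 𝕜 mM m)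
  exact AnalyticAt.comp (g := f) (f := A) (x := (u.1, v))
    (hf _ (SolutionSubmanifold.IsGraphRadius.fst_mem (extend_mem_ball hu)) _ (extend_mem_ball hv))
    (A.analyticAt _)

theorem analyticAt_comp_reduce {f : (Fin nM → 𝕜) × Pt 𝕜 mM → 𝕜} {hn : nM ≤ n} {hm : mM ≤ m}
    {u : Pt 𝕜 n} {v : Pt 𝕜 m} (hf : AnalyticAt 𝕜 f (firstCoords hn u.1, reduce hm v)) :
    AnalyticAt 𝕜 (fun z : (Fin n → 𝕜) × Pt 𝕜 m => f (firstCoords hn z.1, reduce hm z.2)) (u.1, v) :=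
  AnalyticAt.comp (g := f) (f := (firstCoordsL 𝕜 hn).prodMap (reduceL 𝕜 hm)) (x := (u.1, v)) hf
    (ContinuousLinearMap.analyticAt _ _)

end Model

namespace SolutionSubmanifold.IsGraphRadius

variable {𝕜 : Type*} [RCLike 𝕜] {n m : ℕ} {M : SolutionSubmanifold 𝕜 n m} {ρ : ℝ}

/-- Straightening near a point of the submanifold at which both ranks are maximal. -/
theorem exists_reduction (h : M.IsGraphRadius ρ) {nM mM : ℕ} (hn : nM ≤ n) (hm : mM ≤ m)
    (hQr : ∀ v ∈ Metric.ball 0 ρ,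
      m ≤ Module.finrank 𝕜 (paramKernel M.Q (Metric.ball 0 ρ) v) + mM)
    (hPr : ∀ u ∈ Metric.ball 0 ρ,
      n ≤ Module.finrank 𝕜 (paramKernel M.P (Metric.ball 0 ρ) u) + nM)
    {Ω : Set (Pt 𝕜 n × Pt 𝕜 m)} (hΩo : IsOpen Ω)
    (hΩρ : ∀ p ∈ Ω, p.1 ∈ Metric.ball (0 : Pt 𝕜 n) ρ ∧ p.2 ∈ Metric.ball (0 : Pt 𝕜 m) ρ)
    {p : Pt 𝕜 n × Pt 𝕜 m} (hp : p ∈ M.locus Ω)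
    (hQp : Module.finrank 𝕜 (paramKernel M.Q (Metric.ball 0 ρ) p.2) + mM = m)
    (hPp : Module.finrank 𝕜 (paramKernel M.P (Metric.ball 0 ρ) p.1) + nM = n) :
    ∃ H : SplitDiffeo 𝕜 (Pt 𝕜 n) (Pt 𝕜 m) (Pt 𝕜 n) (Pt 𝕜 m),
        p ∈ H.source ∧ H.source ⊆ Ω ∧ H.F p.1 = 0 ∧ H.Φ p.2 = 0 ∧
      ∃ (Q' : (Fin n → 𝕜) × Pt 𝕜 m → 𝕜) (P' : (Fin m → 𝕜) × Pt 𝕜 n → 𝕜)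
        (Qr : (Fin nM → 𝕜) × Pt 𝕜 mM → 𝕜) (Pr : (Fin mM → 𝕜) × Pt 𝕜 nM → 𝕜)
        (Mr : Set (Pt 𝕜 nM × Pt 𝕜 mM)),
        HasGraphEquations H.F.target H.Φ.target (H.image (M.locus Ω)) Q' P' ∧
        (∀ x ab, Q' (x, ab) = Qr (firstCoords hn x, reduce hm ab)) ∧
        (∀ a xy, P' (a, xy) = Pr (firstCoords hm a, reduce hn xy)) ∧
        HasGraphEquations (reduce hn '' H.F.target) (reduce hm '' H.Φ.target) Mr Qr Pr ∧
        (∀ q ∈ Mr, FinitelyNondegenerateAt Qr (q.1.1, q.2) ∧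
          FinitelyNondegenerateAt Pr (q.2.1, q.1)) ∧
        (∀ q ∈ Mr,
          (¬ ∃ N : Set ((Fin nM → 𝕜) × Pt 𝕜 mM), LocallyEquivalentAt 𝕜 Mr q (prodLineVar N)) ∧
          (¬ ∃ N : Set (Pt 𝕜 nM × (Fin mM → 𝕜)),
            LocallyEquivalentAt 𝕜 Mr q (prodLinePar N))) := by
  obtain ⟨u₀, v₀⟩ := p
  obtain ⟨hpΩ, hR⟩ := hp
  obtain ⟨hu₀, hv₀⟩ := hΩρ _ hpΩ
  simp only at hu₀ hv₀ hQp hPp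
  obtain ⟨Φ₀, hΦ₀s, hΦ₀⟩ := exists_isStraightening Metric.isOpen_ball h.analytic_Q hm hQr hv₀ hQp
    (fst_mem hu₀) (h.fderiv_Q_ne_zero hu₀ hv₀ hR)
  obtain ⟨F₀, hF₀s, hF₀⟩ := exists_isStraightening Metric.isOpen_ball h.analytic_P hn hPr hu₀ hPp
    (fst_mem hv₀) (h.dual.fderiv_Q_ne_zero hv₀ hu₀ hR)
  obtain ⟨M', hM'⟩ := h.exists_transformed hu₀ hv₀ hR hF₀ hΦ₀
  have hnhds : {q : Pt 𝕜 n × Pt 𝕜 m | q.1 ∈ F₀.target ∧ q.2 ∈ Φ₀.target ∧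
      (F₀.symm q.1, Φ₀.symm q.2) ∈ Ω} ∈ 𝓝 0 := by
    have e1 : ∀ᶠ q : Pt 𝕜 n × Pt 𝕜 m in 𝓝 0, q.1 ∈ F₀.target :=
      (continuousAt_fst (p := (0 : Pt 𝕜 n × Pt 𝕜 m))).eventually_mem
        (F₀.open_target.mem_nhds hF₀.zero_mem_target)
    have e2 : ∀ᶠ q : Pt 𝕜 n × Pt 𝕜 m in 𝓝 0, q.2 ∈ Φ₀.target :=
      (continuousAt_snd (p := (0 : Pt 𝕜 n × Pt 𝕜 m))).eventually_mem
        (Φ₀.open_target.mem_nhds hΦ₀.zero_mem_target)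
    have hc : ContinuousAt (fun q : Pt 𝕜 n × Pt 𝕜 m => (F₀.symm q.1, Φ₀.symm q.2)) 0 :=
      (ContinuousAt.comp' (f := Prod.fst) (x := (0 : Pt 𝕜 n × Pt 𝕜 m))
        (F₀.symm.continuousAt hF₀.zero_mem_target) continuousAt_fst).prodMk
      (ContinuousAt.comp' (f := Prod.snd) (x := (0 : Pt 𝕜 n × Pt 𝕜 m))
        (Φ₀.symm.continuousAt hΦ₀.zero_mem_target) continuousAt_snd)
    have e3 : ∀ᶠ q : Pt 𝕜 n × Pt 𝕜 m in 𝓝 0, (F₀.symm q.1, Φ₀.symm q.2) ∈ Ω := by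
      refine hc.eventually_mem (hΩo.mem_nhds ?_)
      change (F₀.symm 0, Φ₀.symm 0) ∈ Ω
      rw [hF₀.symm_zero, hΦ₀.symm_zero]
      exact hpΩ
    filter_upwards [e1, e2, e3] with q h1 h2 h3 using ⟨h1, h2, h3⟩
  -- One radius ε serves for both new graphed equations and keeps the preimage of the product of
  -- balls inside Ω; both targets are then cut down to these balls.
  obtain ⟨ε, hε, hεO⟩ := M'.exists_isGraphRadius hnhds
  set F := restrTarget F₀ (Metric.isOpen_ball (x := (0 : Pt 𝕜 n)) (ε := ε)) with hFdef
  set Φ := restrTarget Φ₀ (Metric.isOpen_ball (x := (0 : Pt 𝕜 m)) (ε := ε)) with hΦdef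
  have hFt : F.target = Metric.ball 0 ε :=
    restrTarget_target_of_subset F₀ _ fun u hu => (hεO u hu 0 hε.zero_mem_ball).1
  have hΦt : Φ.target = Metric.ball 0 ε :=
    restrTarget_target_of_subset Φ₀ _ fun v hv => (hεO 0 hε.zero_mem_ball v hv).2.1
  have hF : IsStraightening M.P (Metric.ball 0 ρ) hn v₀.1 u₀ F := hF₀.restr _ hε.zero_mem_ball
  have hΦ : IsStraightening M.Q (Metric.ball 0 ρ) hm u₀.1 v₀ Φ := hΦ₀.restr _ hε.zero_mem_ball
  have hFs : F.source ⊆ Metric.ball 0 ρ := (restrTarget_source_subset F₀ _).trans hF₀s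
  have hΦs : Φ.source ⊆ Metric.ball 0 ρ := (restrTarget_source_subset Φ₀ _).trans hΦ₀s
  have hM'F : ∀ u v, M'.R (u, v) = M.R (F.symm u, Φ.symm v) := hM'
  have hsΩ : ∀ u ∈ Metric.ball (0 : Pt 𝕜 n) ε, ∀ v ∈ Metric.ball (0 : Pt 𝕜 m) ε,
      (F.symm u, Φ.symm v) ∈ Ω := fun u hu v hv => (hεO u hu v hv).2.2
  have hFm : ∀ u ∈ Metric.ball (0 : Pt 𝕜 n) ε, F.symm u ∈ Metric.ball (0 : Pt 𝕜 n) ρ :=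
    fun u hu => hFs (F.map_target (by rwa [hFt]))
  have hΦm : ∀ v ∈ Metric.ball (0 : Pt 𝕜 m) ε, Φ.symm v ∈ Metric.ball (0 : Pt 𝕜 m) ρ :=
    fun v hv => hΦs (Φ.map_target (by rwa [hΦt]))
  have hRQ : ∀ u ∈ Metric.ball (0 : Pt 𝕜 n) ε, ∀ v ∈ Metric.ball (0 : Pt 𝕜 m) ε,
      M'.R (u, v) = 0 ↔ (F.symm u).2 = M.Q ((F.symm u).1, Φ.symm v) := fun u hu v hv => by
    rw [hM'F]; exact h.eq_Q _ (hFm u hu) _ (hΦm v hv)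
  have hRP : ∀ u ∈ Metric.ball (0 : Pt 𝕜 n) ε, ∀ v ∈ Metric.ball (0 : Pt 𝕜 m) ε,
      M'.R (u, v) = 0 ↔ (Φ.symm v).2 = M.P ((Φ.symm v).1, F.symm u) := fun u hu v hv => by
    rw [hM'F]; exact h.eq_P _ (hFm u hu) _ (hΦm v hv)
  -- The superfluous parameters are set to zero using y = Q with u fixed, then the superfluous
  -- variables using b = P with v fixed. Only the zero set of `M'.R` is invariant; `M'.Q` and `M'.P`
  -- themselves are not claimed to be.
  have hinv : ∀ u ∈ Metric.ball (0 : Pt 𝕜 n) ε, ∀ v ∈ Metric.ball (0 : Pt 𝕜 m) ε,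
      M'.R (u, v) = 0 ↔
        M'.R (extend 𝕜 nM n (reduce hn u), extend 𝕜 mM m (reduce hm v)) = 0 := by
    intro u hu v hv
    have hu' : extend 𝕜 nM n (reduce hn u) ∈ Metric.ball (0 : Pt 𝕜 n) ε :=
      extend_mem_ball (reduce_mem_ball hn hu)
    have hv' : extend 𝕜 mM m (reduce hm v) ∈ Metric.ball (0 : Pt 𝕜 m) ε :=
      extend_mem_ball (reduce_mem_ball hm hv)
    rw [hRQ u hu v hv, hΦ.eq_of_reduce_eq h.analytic_Q hΦs hΦt (by rwa [hΦt]) (by rwa [hΦt])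
      (reduce_extend hm _).symm (fst_mem (hFm u hu)), ← hRQ u hu _ hv', hRP u hu _ hv',
      hF.eq_of_reduce_eq h.analytic_P hFs hFt (by rwa [hFt]) (by rwa [hFt])
      (reduce_extend hn _).symm (fst_mem (hΦm _ hv')), ← hRP _ hu' _ hv']
  -- Truncation and zero extension keep the last coordinate, so solving the zero-extended equation
  -- for y' already gives a graph independent of the superfluous coordinates.
  have hRr : ∀ u ∈ Metric.ball (0 : Pt 𝕜 n) ε, ∀ v ∈ Metric.ball (0 : Pt 𝕜 m) ε,
      M'.R (u, v) = 0 ↔ u.2 = restrictGraph M'.Q nM mM (firstCoords hn u.1, reduce hm v) := by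
    intro u hu v hv
    rw [hinv u hu v hv, hε.eq_Q _ (extend_mem_ball (reduce_mem_ball hn hu)) _
      (extend_mem_ball (reduce_mem_ball hm hv))]
    rfl
  have hRr' : ∀ u ∈ Metric.ball (0 : Pt 𝕜 n) ε, ∀ v ∈ Metric.ball (0 : Pt 𝕜 m) ε,
      M'.R (u, v) = 0 ↔ v.2 = restrictGraph M'.P mM nM (firstCoords hm v.1, reduce hn u) := by
    intro u hu v hv
    rw [hinv u hu v hv, hε.eq_P _ (extend_mem_ball (reduce_mem_ball hn hu)) _
      (extend_mem_ball (reduce_mem_ball hm hv))]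
    rfl
  have hQa : ∀ u ∈ Metric.ball (0 : Pt 𝕜 nM) ε, ∀ v ∈ Metric.ball (0 : Pt 𝕜 mM) ε,
      AnalyticAt 𝕜 (restrictGraph M'.Q nM mM) (u.1, v) :=
    fun u hu v hv => analyticAt_restrictGraph hε.analytic_Q hu hv
  have hPa : ∀ u ∈ Metric.ball (0 : Pt 𝕜 nM) ε, ∀ v ∈ Metric.ball (0 : Pt 𝕜 mM) ε,
      AnalyticAt 𝕜 (restrictGraph M'.P mM nM) (v.1, u) :=
    fun u hu v hv => analyticAt_restrictGraph hε.analytic_P hv hu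
  let H : SplitDiffeo 𝕜 (Pt 𝕜 n) (Pt 𝕜 m) (Pt 𝕜 n) (Pt 𝕜 m) :=
    ⟨F, Φ, hF.analytic, hF.analytic_symm, hΦ.analytic, hΦ.analytic_symm⟩
  have hHΩ : H.source ⊆ Ω := by
    rintro ⟨u, v⟩ ⟨hu, hv⟩
    have h1 := hsΩ (F u) (hFt ▸ F.map_source hu) (Φ v) (hΦt ▸ Φ.map_source hv)
    rwa [F.left_inv hu, Φ.left_inv hv] at h1
  have himg : ∀ q : Pt 𝕜 n × Pt 𝕜 m, q ∈ H.image (M.locus Ω) ↔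
      q ∈ Metric.ball (0 : Pt 𝕜 n) ε ×ˢ Metric.ball (0 : Pt 𝕜 m) ε ∧ M'.R (q.1, q.2) = 0 := by
    rintro ⟨u, v⟩
    constructor
    · rintro ⟨⟨x, y⟩, ⟨hxy, hx, hy⟩, hq⟩
      obtain ⟨rfl, rfl⟩ : F x = u ∧ Φ y = v := ⟨congrArg Prod.fst hq, congrArg Prod.snd hq⟩
      refine ⟨⟨hFt ▸ F.map_source hx, hΦt ▸ Φ.map_source hy⟩, ?_⟩
      simp only [hM'F]
      rw [F.left_inv hx, Φ.left_inv hy]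
      exact hxy.2
    · rintro ⟨⟨hu, hv⟩, hq⟩
      have hu' : u ∈ F.target := hFt ▸ hu
      have hv' : v ∈ Φ.target := hΦt ▸ hv
      refine ⟨(F.symm u, Φ.symm v), ⟨⟨hsΩ u hu v hv, ?_⟩, F.map_target hu', Φ.map_target hv'⟩,
        Prod.ext (F.right_inv hu') (Φ.right_inv hv')⟩
      rw [← hM'F]
      exact hq
  let Mr : Set (Pt 𝕜 nM × Pt 𝕜 mM) :=
    {q | q ∈ Metric.ball (0 : Pt 𝕜 nM) ε ×ˢ Metric.ball (0 : Pt 𝕜 mM) ε ∧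
      M'.R (extend 𝕜 nM n q.1, extend 𝕜 mM m q.2) = 0}
  have hMrQ : Mr = {q | q ∈ Metric.ball (0 : Pt 𝕜 nM) ε ×ˢ Metric.ball (0 : Pt 𝕜 mM) ε ∧
      q.1.2 = restrictGraph M'.Q nM mM (q.1.1, q.2)} := by
    ext q
    refine and_congr_right fun hq => ?_
    exact hε.eq_Q _ (extend_mem_ball hq.1) _ (extend_mem_ball hq.2)
  have hMrP : Mr = {q | q ∈ Metric.ball (0 : Pt 𝕜 nM) ε ×ˢ Metric.ball (0 : Pt 𝕜 mM) ε ∧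
      q.2.2 = restrictGraph M'.P mM nM (q.2.1, q.1)} := by
    ext q
    refine and_congr_right fun hq => ?_
    exact hε.eq_P _ (extend_mem_ball hq.1) _ (extend_mem_ball hq.2)
  have hkerQ : ∀ q ∈ Mr, ∀ t, (∀ᶠ x in 𝓝 q.1.1,
      fderiv 𝕜 (restrictGraph M'.Q nM mM) (x, q.2) (0, t) = 0) → t = 0 := by
    intro q hq t ht
    rw [hMrQ] at hq
    refine eq_zero_of_reduced_fderiv_eq_zero (hs := hn) Metric.isOpen_ball
      (isPreconnected_ball (𝕜 := 𝕜) ρ) h.analytic_Q hF.analytic_symm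
      (fun u hu => fst_mem (hFs hu)) hΦ hΦs hFt hΦt hQa ?_ hq.1.1 hq.1.2 hq.2 ht
    intro u hu v hv
    rw [hFt] at hu
    rw [hΦt] at hv
    exact (hRr u hu v hv).symm.trans (hRQ u hu v hv)
  have hkerP : ∀ q ∈ Mr, ∀ t, (∀ᶠ a in 𝓝 q.2.1,
      fderiv 𝕜 (restrictGraph M'.P mM nM) (a, q.1) (0, t) = 0) → t = 0 := by
    intro q hq t ht
    rw [hMrP] at hq
    refine eq_zero_of_reduced_fderiv_eq_zero (hs := hm) Metric.isOpen_ball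
      (isPreconnected_ball (𝕜 := 𝕜) ρ) h.analytic_P hΦ.analytic_symm
      (fun v hv => fst_mem (hΦs hv)) hF hFs hΦt hFt (fun v hv u hu => hPa u hu v hv)
      ?_ hq.1.2 hq.1.1 hq.2 ht
    intro v hv u hu
    rw [hFt] at hu
    rw [hΦt] at hv
    exact (hRr' u hu v hv).symm.trans (hRP u hu v hv)
  refine ⟨H, ⟨hF.mem_source, hΦ.mem_source⟩, hHΩ, hF.map_eq_zero, hΦ.map_eq_zero,
    fun z => restrictGraph M'.Q nM mM (firstCoords hn z.1, reduce hm z.2),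
    fun z => restrictGraph M'.P mM nM (firstCoords hm z.1, reduce hn z.2),
    restrictGraph M'.Q nM mM, restrictGraph M'.P mM nM, Mr, ?_, fun _ _ => rfl, fun _ _ => rfl,
    ?_, ?_, ?_⟩
  · change HasGraphEquations F.target Φ.target _ _ _
    rw [hFt, hΦt]
    refine ⟨Metric.isOpen_ball, Metric.isOpen_ball, ?_, ?_, ?_, ?_⟩
    · exact fun u hu v hv => analyticAt_comp_reduce
        (hQa _ (reduce_mem_ball hn hu) _ (reduce_mem_ball hm hv))
    · exact fun u hu v hv => analyticAt_comp_reduce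
        (hPa _ (reduce_mem_ball hn hu) _ (reduce_mem_ball hm hv))
    · ext q
      rw [himg]
      exact and_congr_right fun hq => hRr q.1 hq.1 q.2 hq.2
    · ext q
      rw [himg]
      exact and_congr_right fun hq => hRr' q.1 hq.1 q.2 hq.2
  · change HasGraphEquations (reduce hn '' F.target) (reduce hm '' Φ.target) _ _ _
    rw [hFt, hΦt, reduce_image_ball, reduce_image_ball]
    exact ⟨Metric.isOpen_ball, Metric.isOpen_ball, hQa, hPa, hMrQ, hMrP⟩
  · intro q hq
    exact ⟨finitelyNondegenerateAt_of_kernel (hQa q.1 hq.1.1 q.2 hq.1.2) (hkerQ q hq),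
      finitelyNondegenerateAt_of_kernel (hPa q.1 hq.1.1 q.2 hq.1.2) (hkerP q hq)⟩
  · intro q hq
    exact ⟨not_locallyEquivalentAt_prodLineVar Metric.isOpen_ball hPa hMrP hq (hkerP q hq),
      not_locallyEquivalentAt_prodLinePar Metric.isOpen_ball hQa hMrQ hq (hkerQ q hq)⟩

end SolutionSubmanifold.IsGraphRadius

end ParaCR

/-! ### Assembling the local reductions -/

theorem theorem15p2 {𝕜 : Type*} [RCLike 𝕜] {n m : ℕ} (M : ParaCR.SolutionSubmanifold 𝕜 n m) :
    ∃ (nM mM : ℕ) (hn : nM ≤ n) (hm : mM ≤ m),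
      M.genrankPar = 1 + mM ∧ M.genrankVar = 1 + nM ∧
      ∀ O ∈ nhds (0 : ParaCR.Pt 𝕜 n × ParaCR.Pt 𝕜 m), ∃ Ω ⊆ O, M.IsAdmissibleDomain Ω ∧
      -- the exceptional set: a proper (nowhere dense) analytic subset
      ∃ Z : Set (ParaCR.Pt 𝕜 n × ParaCR.Pt 𝕜 m),
        ParaCR.IsAnalyticSubset 𝕜 Z (M.locus Ω) ∧ M.locus Ω ⊆ closure (M.locus Ω \ Z) ∧
      ∀ p ∈ M.locus Ω \ Z,
      -- the change of coordinates near `p`, centred at `p`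
      ∃ H : ParaCR.SplitDiffeo 𝕜 (ParaCR.Pt 𝕜 n) (ParaCR.Pt 𝕜 m) (ParaCR.Pt 𝕜 n) (ParaCR.Pt 𝕜 m),
        p ∈ H.source ∧ H.source ⊆ Ω ∧ H.F p.1 = 0 ∧ H.Φ p.2 = 0 ∧
      ∃ (Q' : (Fin n → 𝕜) × ParaCR.Pt 𝕜 m → 𝕜) (P' : (Fin m → 𝕜) × ParaCR.Pt 𝕜 n → 𝕜)
        (Qr : (Fin nM → 𝕜) × ParaCR.Pt 𝕜 mM → 𝕜) (Pr : (Fin mM → 𝕜) × ParaCR.Pt 𝕜 nM → 𝕜)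
        (Mr : Set (ParaCR.Pt 𝕜 nM × ParaCR.Pt 𝕜 mM)),
        -- the transformed submanifold and its equations
        ParaCR.HasGraphEquations H.F.target H.Φ.target (H.image (M.locus Ω)) Q' P' ∧
        -- which do not depend on the last coordinates
        (∀ x ab, Q' (x, ab) = Qr (ParaCR.firstCoords hn x, ParaCR.reduce hm ab)) ∧
        (∀ a xy, P' (a, xy) = Pr (ParaCR.firstCoords hm a, ParaCR.reduce hn xy)) ∧
        -- the reduced submanifold, given by the same equations
        ParaCR.HasGraphEquations (ParaCR.reduce hn '' H.F.target) (ParaCR.reduce hm '' H.Φ.target)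
          Mr Qr Pr ∧
        (∀ q ∈ Mr, ParaCR.FinitelyNondegenerateAt Qr (q.1.1, q.2) ∧
          ParaCR.FinitelyNondegenerateAt Pr (q.2.1, q.1)) ∧
        (∀ q ∈ Mr,
          (¬ ∃ N : Set ((Fin nM → 𝕜) × ParaCR.Pt 𝕜 mM),
            ParaCR.LocallyEquivalentAt 𝕜 Mr q (ParaCR.prodLineVar N)) ∧
          (¬ ∃ N : Set (ParaCR.Pt 𝕜 nM × (Fin mM → 𝕜)),
            ParaCR.LocallyEquivalentAt 𝕜 Mr q (ParaCR.prodLinePar N))) := by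
  -- The two integers are fixed before the neighbourhood `O` is given. The radius depends on `O`,
  -- but the generic ranks do not, so the integers found later coincide with these.
  obtain ⟨ρ₀, h₀, -⟩ := M.exists_isGraphRadius Filter.univ_mem
  obtain ⟨mM, hm, hmM, -⟩ := h₀.exists_generic_rank
  obtain ⟨nM, hn, hnM, -⟩ := h₀.dual.exists_generic_rank
  refine ⟨nM, mM, hn, hm, hmM, hnM, fun O hO => ?_⟩
  obtain ⟨ρ, h, hρO⟩ := M.exists_isGraphRadius hO
  obtain ⟨mM', -, hmM', hQr, g, hga, hg0, hg⟩ := h.exists_generic_rank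
  obtain ⟨nM', -, hnM', hPr, g', hga', hg0', hg'⟩ := h.dual.exists_generic_rank
  obtain rfl : mM' = mM := by omega
  obtain rfl : nM' = nM := by omega
  obtain ⟨δ, hδ0, hδρ, hδ⟩ := h.exists_box_radius
  have hΩρ := fun p (hp : p ∈ ParaCR.SolutionSubmanifold.box 𝕜 n m δ ρ) =>
    ParaCR.SolutionSubmanifold.mem_ball_of_mem_box hδρ hp
  refine ⟨ParaCR.SolutionSubmanifold.box 𝕜 n m δ ρ,
    fun p hp => hρO p.1 (hΩρ p hp).1 p.2 (hΩρ p hp).2, h.isAdmissibleDomain_box hδ0 hδρ hδ, _,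
    ParaCR.SolutionSubmanifold.IsGraphRadius.isAnalyticSubset hδρ hga hga',
    h.locus_subset_closure hδ0 hδρ hδ hga hg0 hga' hg0', ?_⟩
  rintro p ⟨hp, hpZ⟩
  -- Off the exceptional set both determinants are nonzero, so both kernels have their minimal
  -- dimension at p.
  have hne : g p.2 * g' p.1 ≠ 0 := fun h0 => hpZ ⟨hp, h0⟩
  exact h.exists_reduction hn hm hQr hPr (ParaCR.SolutionSubmanifold.isOpen_box δ ρ) hΩρ hp
    (hg _ (hΩρ p hp.1).2 (left_ne_zero_of_mul hne)) (hg' _ (hΩρ p hp.1).1 (right_ne_zero_of_mul hne))
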